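/- **Finite-sum complexity.** Consider $\min_{x\in\mathbf R^d} F(x):=\frac1m\sum_{i=1}^m h_i(c_i(x))+g(x)$ with $m\ge 1$, where $g:\mathbf R^d\to\mathbf R\cup\{+\infty\}$ is proper, closed and convex, each $h_i:\mathbf R\to\mathbf R$ is convex and $L$-Lipschitz, each $c_i:\mathbf R^d\to\mathbf R$ is $C^1$ with $\beta$-Lipschitz gradient, and a real number $\|\nabla c\|\ge\sup_{x\in\operatorname{dom}g}\max_i\|\nabla c_i(x)\|$ is given. Assume $\inf F>-\infty$, let $x_0\in\operatorname{dom} g$, $\varepsilon>0$, and put $\mu:=L\beta$. Let $$\mathcal G_{1/\mu}(x):=\mu\Big(x-\operatorname*{argmin}_z\Big\{\tfrac1m\sum_{i=1}^m h_i\big(c_i(x)+\langle\nabla c_i(x),z-x\rangle\big)+g(z)+\tfrac{\mu}{2}\|z-x\|^2\Big\}\Big)$$ be the prox-gradient. A basic operation is one evaluation of $c_i(x)$, of $\nabla c_i(x)$, of a dot product $\langle\nabla c_i(x),v\rangle$, of $\mathrm{prox}_{th_i}$ or of $\mathrm{prox}_{tg}$. *The method.* Set $\nu:=\frac{m\varepsilon^2}{2L^3\beta}$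 and replace $h_i$ by $\phi_i:=m\,(h_i/m)_\nu$, where $f_\nu(s)=\inf_u\{f(u)+\frac1{2\nu}(u-s)^2\}$ is the Moreau envelope, so that $\phi_i'(s)=\frac m\nu\big(s-\mathrm{prox}_{\frac\nu m h_i}(s)\big)$. Given $x_k$, consider the subproblem $\min_z \frac1m\sum_i f_i(z)+p(z)$ with $f_i(z)=\phi_i(c_i(x_k)+\langle\nabla c_i(x_k),z-x_k\rangle)$ and $p(z)=g(z)+\frac\mu2\|z-x_k\|^2$, and put $\ell_k:=\max\{\frac m\nu\max_i\|\nabla c_i(x_k)\|^2,\ \mu\}$, $\kappa_k:=\ell_k/\mu$. Take the prox-gradient step $\hat z=\mathrm{prox}_{p/\ell_k}\big(x_k-\frac1{\ell_k}\frac1m\sum_i\nabla f_i(x_k)\big)$ and, from $\hat z$, run either * Prox-SVRG for $T^{S}_k=\lceil 10\log(2\kappa_k)\rceil$ epochs: an epoch sends $\tilde x$ to $\frac1J\sum_{j=1}^J x_j$, where $x_0=\tilde x$, $x_j=\mathrm{prox}_{\eta p}(x_{j-1}-\eta v_j)$, $v_j=\frac1m\sum_i\nabla f_i(\tilde x)+\nabla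 f_{i_j}(x_{j-1})-\nabla f_{i_j}(\tilde x)$, $\eta=\frac1{10\ell_k}$, $J=\lceil100\kappa_k\rceil$, and the $i_j$ are independent and uniform on $\{1,\dots,m\}$; or * Katyusha for $T^{K}_k=\big\lceil \max\{3,1+\sqrt{3\kappa_k/(2m)}\}\log(8\kappa_k)\big\rceil$ epochs: with $\tau=\min\{\sqrt{2m/(3\kappa_k)},\frac12\}$, $a=\frac1{3\tau\ell_k}$, $\theta=1+a\mu$ and starting values $\tilde x=y_0=z_0=\hat z$, an epoch performs, for $j=0,\dots,2m-1$, $w_j=\tau z_j+\frac12\tilde x+(\frac12-\tau)y_j$, $v_j=\frac1m\sum_i\nabla f_i(\tilde x)+\nabla f_{i_j}(w_j)-\nabla f_{i_j}(\tilde x)$, $z_{j+1}=\mathrm{prox}_{ap}(z_j-av_j)$, $y_{j+1}=\mathrm{prox}_{p/(3\ell_k)}(w_j-\frac1{3\ell_k}v_j)$, with $i_j$ independent and uniform, then replaces $\tilde x$ by $\big(\sum_{j<2m}\theta^j\big)^{-1}\sum_{j<2m}\theta^jy_{j+1}$ and $(y_0,z_0)$ by $(y_{2m},z_{2m})$. Prox-SVRG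 is used if $T^S_k(m+2J)\le 3mT^K_k$, and Katyusha otherwise. The last $\tilde x$ is $x_{k+1}$. *The claim.* There are absolute constants $K,C>0$ such that, for all problems as above (with any $d$ and $m$) for which $\|\nabla c\|$, $L$, $\beta$, $F(x_0)-\inf F$ and $1/\varepsilon$ are all at least $K$, there is an $N$ such that the first $N$ outer steps of the method take, for every outcome of the random draws, at most $$C\left(\frac{L\beta m}{\varepsilon^2}+\frac{L^2\beta\|\nabla c\|}{\varepsilon^3}\min\Big\{\sqrt m,\frac{L\|\nabla c\|}{\varepsilon}\Big\}\right)\big(F(x_0)-\inf F\big)\log\Big(\frac{L\|\nabla c\|}{\varepsilon}\Big)$$ basic operations, and one of the iterates $x=x_j$, $0\le j<N$, satisfies $\mathbb E\|\mathcal G_{1/\mu}(x)\|^2\le\varepsilon^2$. -/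

import Mathlib

open scoped Gradient InnerProductSpace

noncomputable section

namespace FiniteSum

/-- `ℝ^d` with the Euclidean norm. -/
abbrev Vec (d : ℕ) : Type := EuclideanSpace ℝ (Fin d)

/-! ### The problem class -/

/-- The data of the problem `min_x (1/m) ∑ᵢ hᵢ(cᵢ(x)) + g(x)`. -/
structure Problem (d m : ℕ) where
  g : Vec d → EReal
  h : Fin m → ℝ → ℝ
  c : Fin m → Vec d → ℝ

/-- The standing assumptions: `g` is proper, closed and convex (through its epigraph), each `hᵢ` is
convex and `L`-Lipschitz, each `cᵢ` is `C¹` with `β`-Lipschitz gradient, and `B` (written `‖∇c‖`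
in the text) bounds all the gradients `∇cᵢ` on `dom g`. -/
structure Problem.Assumptions {d m : ℕ} (P : Problem d m) (L β B : ℝ) : Prop where
  g_ne_bot : ∀ x, P.g x ≠ ⊥
  g_proper : ∃ x, P.g x ≠ ⊤
  g_closed : IsClosed {p : Vec d × ℝ | P.g p.1 ≤ (p.2 : EReal)}
  g_convex : Convex ℝ {p : Vec d × ℝ | P.g p.1 ≤ (p.2 : EReal)}
  h_convex : ∀ i, ConvexOn ℝ Set.univ (P.h i)
  h_lip : ∀ i s t, |P.h i s - P.h i t| ≤ L * |s - t|
  c_smooth : ∀ i, ContDiff ℝ 1 (P.c i)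
  c_lip : ∀ i x y, ‖∇ (P.c i) x - ∇ (P.c i) y‖ ≤ β * ‖x - y‖
  grad_bound : ∀ x, P.g x ≠ ⊤ → ∀ i, ‖∇ (P.c i) x‖ ≤ B

/-- The objective `F(x) = (1/m) ∑ᵢ hᵢ(cᵢ(x)) + g(x)`. -/
def Problem.F {d m : ℕ} (P : Problem d m) (x : Vec d) : EReal :=
  (((1 / m : ℝ) * ∑ i, P.h i (P.c i x) : ℝ) : EReal) + P.g x

/-- The prox-linear model
`F_t(z; x) = (1/m) ∑ᵢ hᵢ(cᵢ(x) + ⟨∇cᵢ(x), z - x⟩) + g(z) + (1/2t) ‖z - x‖²`. -/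
def Problem.model {d m : ℕ} (P : Problem d m) (t : ℝ) (x z : Vec d) : EReal :=
  (((1 / m : ℝ) * ∑ i, P.h i (P.c i x + ⟪∇ (P.c i) x, z - x⟫_ℝ)
      + 1 / (2 * t) * ‖z - x‖ ^ 2 : ℝ) : EReal) + P.g z

/-- A global minimizer of `f`, if there is one. (All functions it is applied to are closed, proper
and strongly convex, so that the minimizer exists and is unique.) -/
def argmin {X : Type} [Nonempty X] (f : X → EReal) : X :=
  Classical.epsilon fun z => ∀ y, f z ≤ f y

/-- The prox-gradient `𝒢_t(x) = t⁻¹ (x - argmin_z F_t(z; x))`. -/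
def Problem.proxGrad {d m : ℕ} (P : Problem d m) (t : ℝ) (x : Vec d) : Vec d :=
  t⁻¹ • (x - argmin (P.model t x))

/-! ### Randomized programs over the basic operations -/

/-- Randomized programs that access the problem only through the basic operations: evaluation of
`cᵢ(x)`, of `∇cᵢ(x)`, of `⟨∇cᵢ(x), v⟩`, of `prox_{t hᵢ}(s)` and of `prox_{t g}(v)`. Besides, a
program may `pick` an index of `{1, …, m}` uniformly at random, independently of the past. -/
inductive Prog (d m : ℕ) (α : Type) : Type where
  | done (a : α) : Prog d m α
  | evalC (i : Fin m) (x : Vec d) (k : ℝ → Prog d m α) : Prog d m α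
  | evalGrad (i : Fin m) (x : Vec d) (k : Vec d → Prog d m α) : Prog d m α
  | dot (i : Fin m) (x v : Vec d) (k : ℝ → Prog d m α) : Prog d m α
  | proxH (i : Fin m) (t s : ℝ) (k : ℝ → Prog d m α) : Prog d m α
  | proxG (t : ℝ) (v : Vec d) (k : Vec d → Prog d m α) : Prog d m α
  | pick (k : Fin m → Prog d m α) : Prog d m α

namespace Prog

variable {d m : ℕ} {α γ : Type}

/-- Sequential composition. -/
def bind : Prog d m α → (α → Prog d m γ) → Prog d m γ
  | done a, f => f a
  | evalC i x k, f => evalC i x fun r => (k r).bind f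
  | evalGrad i x k, f => evalGrad i x fun r => (k r).bind f
  | dot i x v k, f => dot i x v fun r => (k r).bind f
  | proxH i t s k, f => proxH i t s fun r => (k r).bind f
  | proxG t v k, f => proxG t v fun r => (k r).bind f
  | pick k, f => pick fun i => (k i).bind f

instance : Monad (Prog d m) where
  pure := done
  bind := bind

end Prog

/-- `prox_{t hᵢ}(s)`. -/
def Problem.proxH {d m : ℕ} (P : Problem d m) (i : Fin m) (t s : ℝ) : ℝ :=
  argmin fun u : ℝ => ((P.h i u + 1 / (2 * t) * (u - s) ^ 2 : ℝ) : EReal)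

/-- `prox_{t g}(v)`. -/
def Problem.proxG {d m : ℕ} (P : Problem d m) (t : ℝ) (v : Vec d) : Vec d :=
  argmin fun z : Vec d => P.g z + ((1 / (2 * t) * ‖z - v‖ ^ 2 : ℝ) : EReal)

namespace Prog

variable {d m : ℕ} {α : Type}

/-- Expectation of `f` at the output of a program run on the problem `P`: the average over the
(finitely many) random draws. -/
def expect (P : Problem d m) (f : α → ℝ) : Prog d m α → ℝ
  | done a => f a
  | evalC i x k => expect P f (k (P.c i x))
  | evalGrad i x k => expect P f (k (∇ (P.c i) x))
  | dot i x v k => expect P f (k ⟪∇ (P.c i) x, v⟫_ℝ)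
  | proxH i t s k => expect P f (k (P.proxH i t s))
  | proxG t v k => expect P f (k (P.proxG t v))
  | pick k => (1 / m : ℝ) * ∑ i, expect P f (k i)

/-- Number of basic operations performed by a program run on the problem `P`, in the worst case
over the random draws. -/
def cost (P : Problem d m) : Prog d m α → ℕ
  | done _ => 0
  | evalC i x k => cost P (k (P.c i x)) + 1
  | evalGrad i x k => cost P (k (∇ (P.c i) x)) + 1
  | dot i x v k => cost P (k ⟪∇ (P.c i) x, v⟫_ℝ) + 1
  | proxH i t s k => cost P (k (P.proxH i t s)) + 1
  | proxG t v k => cost P (k (P.proxG t v)) + 1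
  | pick k => Finset.univ.sup fun i => cost P (k i)

/-- Run `f 0, f 1, …, f (n - 1)` in this order, passing on a state. -/
def loop (f : ℕ → α → Prog d m α) (a : α) : ℕ → Prog d m α
  | 0 => pure a
  | n + 1 => do
    let b ← loop f a n
    f n b

/-- Run one program for each index and collect the results. -/
def collect : {n : ℕ} → (Fin n → Prog d m α) → Prog d m (Fin n → α)
  | 0, _ => pure Fin.elim0
  | _ + 1, f => do
    let a ← f 0
    let r ← collect fun i => f i.succ
    pure (Fin.cons a r)

end Prog

open Prog

/-! ### The smoothed proximal subproblem

With the smoothing parameter `ν`, the function `hᵢ` is replaced by `φᵢ = m (hᵢ / m)_ν`, where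
`(·)_ν` is the Moreau envelope; its derivative is `φᵢ'(s) = (m / ν) (s - prox_{(ν/m) hᵢ}(s))`. The
subproblem at `x` is `min_z (1/m) ∑ᵢ fᵢ(z) + p(z)` with `fᵢ(z) = φᵢ(cᵢ(x) + ⟨∇cᵢ(x), z - x⟩)` and
`p(z) = g(z) + (1/2t) ‖z - x‖²`. -/

/-- A subproblem, as it is known to the algorithm: the parameters `ν` and `t`, the prox-center `x`,
the values `cᵢ(x)` and `∇cᵢ(x)`, and the constant `ℓ`. -/
structure Subproblem (d m : ℕ) where
  ν : ℝ
  t : ℝ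
  x : Vec d
  cval : Fin m → ℝ
  cgrad : Fin m → Vec d
  ℓ : ℝ

namespace Subproblem

variable {d m : ℕ} (S : Subproblem d m)

/-- The condition number `κ = ℓ / α`, where `α = 1 / t`. -/
def κ : ℝ := S.ℓ * S.t

/-- `∇fᵢ(z) = φᵢ'(cᵢ(x) + ⟨∇cᵢ(x), z - x⟩) ∇cᵢ(x)`. -/
def gradf (i : Fin m) (z : Vec d) : Prog d m (Vec d) :=
  dot i S.x (z - S.x) fun r =>
  Prog.proxH i (S.ν / m) (S.cval i + r) fun u =>
  pure ((m / S.ν * (S.cval i + r - u)) • S.cgrad i)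

/-- `prox_{η p}(v)`, by completing the square in `p(z) + (1/2η) ‖z - v‖²`. -/
def proxp (η : ℝ) (v : Vec d) : Prog d m (Vec d) :=
  Prog.proxG (η * S.t / (η + S.t)) ((η + S.t)⁻¹ • (S.t • v + η • S.x)) pure

/-- All the gradients `∇fᵢ(z)`. -/
def gradAll (z : Vec d) : Prog d m (Fin m → Vec d) :=
  collect fun i => S.gradf i z

/-- The initial prox-gradient step `prox_{p/ℓ}(z - (1/ℓ) (1/m) ∑ᵢ ∇fᵢ(z))` that turns Prox-SVRG and
Katyusha into Prox-SVRG⁺ and Katyusha⁺. -/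
def proxGradStep (z : Vec d) : Prog d m (Vec d) := do
  let G ← S.gradAll z
  S.proxp (1 / S.ℓ) (z - (1 / S.ℓ) • ((1 / m : ℝ) • ∑ i, G i))

/-! #### Prox-SVRG -/

/-- The epoch length `J` of Prox-SVRG. -/
def svrgJ : ℕ := ⌈100 * S.κ⌉₊

/-- One step `x̃_{s-1} ↦ x̃_s` of Prox-SVRG with step size `η = 1 / (10 ℓ)`. The state of the inner
loop is `(x_j, x_1 + ⋯ + x_j)`. -/
def svrgEpoch (xt : Vec d) : Prog d m (Vec d) := do
  let η : ℝ := 1 / (10 * S.ℓ)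
  let G ← S.gradAll xt
  let vt : Vec d := (1 / m : ℝ) • ∑ i, G i
  let r ← loop (fun _ (s : Vec d × Vec d) => pick fun i => do
    let a ← S.gradf i s.1
    let b ← S.gradf i xt
    let y ← S.proxp η (s.1 - η • (vt + (a - b)))
    pure (y, s.2 + y)) (xt, 0) S.svrgJ
  pure ((1 / S.svrgJ : ℝ) • r.2)

/-- `T` iterations of Prox-SVRG⁺ from `z₀`. -/
def svrgPlus (T : ℕ) (z₀ : Vec d) : Prog d m (Vec d) := do
  let z ← S.proxGradStep z₀
  loop (fun _ xt => S.svrgEpoch xt) z T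

/-! #### Katyusha -/

/-- The parameter `τ₁` of Katyusha; the epoch length is `2m`, and the parameter `τ₂` is `1/2`. -/
def katτ₁ : ℝ := min (√(2 * m / (3 * S.κ))) (1 / 2)

/-- The step size of Katyusha. -/
def katα : ℝ := 1 / (3 * S.katτ₁ * S.ℓ)

/-- The weight base `θ = 1 + (step size) * (strong convexity constant of p)`. -/
def katθ : ℝ := 1 + S.katα / S.t

/-- One epoch of Katyusha on the state `(x̃, y, z)`. The state of the inner loop is
`(y, z, ∑_j θ^j y_{j+1})`. -/
def katEpoch (st : Vec d × Vec d × Vec d) : Prog d m (Vec d × Vec d × Vec d) := do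
  let xt := st.1
  let G ← S.gradAll xt
  let vt : Vec d := (1 / m : ℝ) • ∑ i, G i
  let r ← loop (fun j (s : Vec d × Vec d × Vec d) => pick fun i => do
    let x : Vec d :=
      S.katτ₁ • s.2.1 + (1 / 2 : ℝ) • xt + (1 - S.katτ₁ - 1 / 2) • s.1
    let a ← S.gradf i x
    let v : Vec d := vt + (a - G i)
    let z ← S.proxp S.katα (s.2.1 - S.katα • v)
    let y ← S.proxp (1 / (3 * S.ℓ)) (x - (1 / (3 * S.ℓ)) • v)
    pure (y, z, s.2.2 + S.katθ ^ j • y)) (st.2.1, st.2.2, 0) (2 * m)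
  pure ((∑ j ∈ Finset.range (2 * m), S.katθ ^ j)⁻¹ • r.2.2, r.1, r.2.1)

/-- `T` iterations of Katyusha⁺ from `z₀`. -/
def katPlus (T : ℕ) (z₀ : Vec d) : Prog d m (Vec d) := do
  let z ← S.proxGradStep z₀
  let r ← loop (fun _ st => S.katEpoch st) (z, z, z) T
  pure r.1

/-! #### Number of inner iterations -/

/-- The number `T = ⌈(1/τ) log(4tγ)⌉` of iterations of a subscheme with
`𝔼[F_t(z_i; x) - min F_t(·; x)] ≤ γ (1 - τ)^i ‖z₀ - z*‖²`. -/
def innerIter (γ τ : ℝ) : ℕ := ⌈1 / τ * Real.log (4 * S.t * γ)⌉₊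

/-- Number of iterations of Prox-SVRG⁺, with `γ = ℓ / 2` and `1 - τ = 0.9`. -/
def svrgT : ℕ := S.innerIter (S.ℓ / 2) (1 / 10)

/-- Number of iterations of Katyusha⁺, with `γ = 4ℓ / 2` and
`1 - τ = max {(1 + √(2m / 3κ))⁻¹, 1.5⁻¹}`. -/
def katT : ℕ :=
  S.innerIter (4 * S.ℓ / 2) (1 - max (1 + √(2 * m / (3 * S.κ)))⁻¹ (3 / 2 : ℝ)⁻¹)

/-- Solve the subproblem approximately by the better of the two methods, in terms of their numbers
of evaluations of individual gradients: `m + 2J` in each iteration of Prox-SVRG⁺ and `3m` in each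
iteration of Katyusha⁺. -/
def solve (z₀ : Vec d) : Prog d m (Vec d) :=
  if S.svrgT * (m + 2 * S.svrgJ) ≤ S.katT * (3 * m) then S.svrgPlus S.svrgT z₀
  else S.katPlus S.katT z₀

end Subproblem

/-! ### The inexact prox-linear method on the smoothed problem -/

/-- The smoothing parameter `ν = m ε² / (2 L³ β)` for the target accuracy `ε`. -/
def smoothing (m : ℕ) (L β ε : ℝ) : ℝ := m * ε ^ 2 / (2 * L ^ 3 * β)

/-- One outer step `x_k ↦ x_{k+1}`, with `t = 1 / (Lβ)`. The functions `fᵢ` of the subproblem have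
`ℓ`-Lipschitz gradients for `ℓ = (m / ν) max_i ‖∇cᵢ(x_k)‖²`; this `ℓ` is raised to `Lβ` if it is
smaller, so that the condition number is at least `1`. -/
def outerStep (d m : ℕ) (L β ε : ℝ) (x : Vec d) : Prog d m (Vec d) := do
  let ν := smoothing m L β ε
  let cval ← collect fun i : Fin m => evalC i x pure
  let cgrad ← collect fun i : Fin m => evalGrad i x pure
  let sq ← collect fun i : Fin m => dot i x (cgrad i) pure
  let S : Subproblem d m :=
    { ν := ν, t := 1 / (L * β), x := x, cval := cval, cgrad := cgrad,
      ℓ := max (m / ν * ⨆ i, sq i) (L * β) }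
  S.solve x

/-- The iterate `x_N` of the method started at `x₀`. -/
def proxLinear (d m : ℕ) (L β ε : ℝ) (x₀ : Vec d) (N : ℕ) : Prog d m (Vec d) :=
  loop (fun _ x => outerStep d m L β ε x) x₀ N

end FiniteSum

end

/-! Write μ = Lβ, ρ = LB/ε, and let z* be the minimizer of the smoothed model at x. The method is
inexact prox-linear descent on the objective with each hᵢ replaced by its Moreau envelope, whose
parameter r = ν/m = ε²/(2L³β) makes the smoothing error at most rL²/2 = ε²/(4μ).

Outer loop. The envelopes are L-Lipschitz and linearizing cᵢ costs β/2 ‖z - x‖², so the model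
majorizes the smoothed objective (`FS_le_model`). By strong convexity the model gap at x is at least
μ/2 ‖x - z*‖², while the inner solver returns a point of expected gap at most μ/4 ‖x - z*‖²
(`solve_spec`). Hence the smoothed objective drops by μ/4 ‖x - z*‖² in expectation
(`expect_outerStep_FS_le`). The true and smoothed models have nearby minimizers, so ‖𝒢‖² ≤ 2μ²‖x -
z*‖² + ε²/2 (`norm_proxGrad_sq_le`), and telescoping yields a good iterate among the first N =
O(μΔ/ε²), where Δ = F(x₀) - inf F (`exists_expect_le`).

Inner loop. The initial prox-gradient step bounds the gap by ℓ/2 times the squared distance to z*. A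
Prox-SVRG epoch then multiplies the expected gap by at most 9/10 (`expect_svrgEpoch`), and T
Katyusha epochs by at most 4(1 + τ)^(-T) (`katyusha_spec`). Both rest on cocoercivity of the
gradients, which bounds the variance of the estimator.

Cost. On dom g the condition number is at most 2ρ² (`κ_le`). Prox-SVRG takes O((m + ρ²) log ρ)
gradient evaluations and Katyusha O((m + ρ√m) log ρ); using the cheaper one produces the minimum in
the bound (`work_le`). -/

noncomputable section

namespace FiniteSum

/-! ### Calculus of expectation, worst-case cost and sure properties of programs. -/

namespace Prog

variable {d m : ℕ} {α γ : Type}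

/-- The predicate `Q` holds at the output of a program run on `P`, for all random draws. -/
def Always (P : Problem d m) (Q : α → Prop) : Prog d m α → Prop
  | done a => Q a
  | evalC i x k => Always P Q (k (P.c i x))
  | evalGrad i x k => Always P Q (k (∇ (P.c i) x))
  | dot i x v k => Always P Q (k ⟪∇ (P.c i) x, v⟫_ℝ)
  | proxH i t s k => Always P Q (k (P.proxH i t s))
  | proxG t v k => Always P Q (k (P.proxG t v))
  | pick k => ∀ i, Always P Q (k i)

variable {P : Problem d m}

theorem expect_bind (f : γ → ℝ) (p : Prog d m α) (k : α → Prog d m γ) :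
    (p >>= k).expect P f = p.expect P fun a => (k a).expect P f := by
  change (p.bind k).expect P f = _
  induction p with
  | done a => rfl
  | pick k' ih => simp only [bind, expect, ih]
  | _ => simp only [bind, expect, *]

theorem always_bind {Q : γ → Prop} {p : Prog d m α} {k : α → Prog d m γ} :
    Always P Q (p >>= k) ↔ Always P (fun a => Always P Q (k a)) p := by
  change Always P Q (p.bind k) ↔ _
  induction p with
  | done a => rfl
  | pick k' ih => simp only [bind, Always, ih]
  | _ => simp only [bind, Always, *]

theorem Always.mono {Q R : α → Prop} {p : Prog d m α} (h : Always P Q p)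
    (hQR : ∀ a, Q a → R a) : Always P R p := by
  induction p with
  | done a => exact hQR a h
  | pick k ih => exact fun i => ih i (h i)
  | evalC i x k ih => exact ih _ h
  | evalGrad i x k ih => exact ih _ h
  | dot i x v k ih => exact ih _ h
  | proxH i t s k ih => exact ih _ h
  | proxG t v k ih => exact ih _ h

theorem Always.bind {Q : α → Prop} {R : γ → Prop} {p : Prog d m α} {k : α → Prog d m γ}
    (h : Always P Q p) (hk : ∀ a, Q a → Always P R (k a)) : Always P R (p >>= k) :=
  always_bind.2 (h.mono hk)

theorem expect_mono {f g : α → ℝ} {p : Prog d m α} (h : Always P (fun a => f a ≤ g a) p) :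
    p.expect P f ≤ p.expect P g := by
  induction p with
  | done a => exact h
  | pick k ih =>
    exact mul_le_mul_of_nonneg_left (Finset.sum_le_sum fun i _ => ih i (h i)) (by positivity)
  | evalC i x k ih => exact ih _ h
  | evalGrad i x k ih => exact ih _ h
  | dot i x v k ih => exact ih _ h
  | proxH i t s k ih => exact ih _ h
  | proxG t v k ih => exact ih _ h

theorem expect_add (f g : α → ℝ) (p : Prog d m α) :
    p.expect P (fun a => f a + g a) = p.expect P f + p.expect P g := by
  induction p with
  | done a => rfl
  | pick k ih => simp only [expect, ih, Finset.sum_add_distrib, mul_add]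
  | _ => simp only [expect, *]

theorem expect_const_mul (r : ℝ) (f : α → ℝ) (p : Prog d m α) :
    p.expect P (fun a => r * f a) = r * p.expect P f := by
  induction p with
  | done a => rfl
  | pick k ih => simp only [expect, ih, ← Finset.mul_sum, mul_left_comm]
  | _ => simp only [expect, *]

theorem expect_const (hm : 0 < m) (r : ℝ) (p : Prog d m α) :
    p.expect P (fun _ => r) = r := by
  induction p with
  | done a => rfl
  | pick k ih =>
    have : (m : ℝ) ≠ 0 := by positivity
    simp [expect, ih, this]
  | _ => simp only [expect, *]

/-- A program with only one possible output. -/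
theorem expect_of_always_eq (hm : 0 < m) {p : Prog d m α} {a : α}
    (h : Always P (fun b => b = a) p) (f : α → ℝ) : p.expect P f = f a := by
  rw [← expect_const (P := P) hm (f a) p]
  exact le_antisymm (expect_mono (h.mono fun b hb => by rw [hb]))
    (expect_mono (h.mono fun b hb => by rw [hb]))

theorem expect_bind_of_always_eq (hm : 0 < m) {p : Prog d m α} {a : α}
    (h : Always P (fun b => b = a) p) (f : γ → ℝ) (k : α → Prog d m γ) :
    (p >>= k).expect P f = (k a).expect P f := by
  rw [expect_bind, expect_of_always_eq hm h]

/-- Cost is a maximum over the draws, so the continuation only has to be bounded at outputs that the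
first program can produce. -/
theorem cost_bind_le {p : Prog d m α} {k : α → Prog d m γ} {b c : ℕ} (hp : p.cost P ≤ b)
    (h : Always P (fun a => (k a).cost P ≤ c) p) : (p >>= k).cost P ≤ b + c := by
  suffices (p.bind k).cost P ≤ p.cost P + c from this.trans (by omega)
  clear hp
  induction p with
  | done a => simpa [Prog.bind, cost, Always] using h
  | pick k' ih =>
    simp only [Prog.bind, cost]
    refine Finset.sup_le fun i _ => (ih i (h i)).trans (Nat.add_le_add_right ?_ _)
    exact Finset.le_sup (f := fun i => cost P (k' i)) (Finset.mem_univ i)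
  | evalC i x k ih => have := ih _ h; simp only [Prog.bind, cost]; omega
  | evalGrad i x k ih => have := ih _ h; simp only [Prog.bind, cost]; omega
  | dot i x v k ih => have := ih _ h; simp only [Prog.bind, cost]; omega
  | proxH i t s k ih => have := ih _ h; simp only [Prog.bind, cost]; omega
  | proxG t v k ih => have := ih _ h; simp only [Prog.bind, cost]; omega

theorem always_of_forall {Q : α → Prop} (h : ∀ a, Q a) (p : Prog d m α) : Always P Q p := by
  induction p with
  | done a => exact h a
  | pick k ih => exact fun i => ih i
  | _ => simp only [Always, *]

/-! #### Loops -/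

theorem always_loop {f : ℕ → α → Prog d m α} {a : α} (I : ℕ → α → Prop) (h0 : I 0 a)
    (hs : ∀ n b, I n b → Always P (I (n + 1)) (f n b)) (N : ℕ) : Always P (I N) (loop f a N) := by
  induction N with
  | zero => exact h0
  | succ n ih => exact ih.bind (hs n)

theorem cost_loop_le {f : ℕ → α → Prog d m α} {a : α} (I : ℕ → α → Prop) (h0 : I 0 a)
    (hs : ∀ n b, I n b → Always P (I (n + 1)) (f n b)) {c : ℕ}
    (hc : ∀ n b, I n b → (f n b).cost P ≤ c) (N : ℕ) : (loop f a N).cost P ≤ N * c := by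
  induction N with
  | zero => simp [loop, pure, cost]
  | succ n ih =>
    rw [Nat.succ_mul]
    exact cost_bind_le ih ((always_loop I h0 hs n).mono (hc n))

/-- A potential that increases by at most `c` in each step, in expectation. -/
theorem expect_loop_le_add (hm : 0 < m) {f : ℕ → α → Prog d m α} {a : α} (I : ℕ → α → Prop)
    (h0 : I 0 a) (hs : ∀ n b, I n b → Always P (I (n + 1)) (f n b)) (V : ℕ → α → ℝ) {c : ℝ}
    (hV : ∀ n b, I n b → (f n b).expect P (V (n + 1)) ≤ V n b + c) (N : ℕ) :
    (loop f a N).expect P (V N) ≤ V 0 a + N * c := by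
  induction N with
  | zero => simp [loop, pure, expect]
  | succ n ih =>
    have h : (loop f a (n + 1)).expect P (V (n + 1)) ≤
        (loop f a n).expect P (fun b => V n b + c) := by
      rw [loop, expect_bind]
      exact expect_mono ((always_loop I h0 hs n).mono (hV n))
    rw [expect_add, expect_const hm] at h
    push_cast
    linarith

/-- A potential that shrinks by the factor `ρ` in each step, in expectation. -/
theorem expect_loop_le_pow {f : ℕ → α → Prog d m α} {a : α} (I : α → Prop) (h0 : I a)
    (hs : ∀ n b, I b → Always P I (f n b)) (V : α → ℝ) {ρ : ℝ} (hρ : 0 ≤ ρ)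
    (hV : ∀ n b, I b → (f n b).expect P V ≤ ρ * V b) (N : ℕ) :
    (loop f a N).expect P V ≤ ρ ^ N * V a := by
  induction N with
  | zero => simp [loop, pure, expect]
  | succ n ih =>
    have h : (loop f a (n + 1)).expect P V ≤ (loop f a n).expect P (fun b => ρ * V b) := by
      rw [loop, expect_bind]
      exact expect_mono ((always_loop (fun _ => I) h0 hs n).mono (hV n))
    rw [expect_const_mul] at h
    rw [pow_succ', mul_assoc]
    exact h.trans (mul_le_mul_of_nonneg_left ih hρ)

/-! #### Collecting results -/

theorem always_collect {n : ℕ} {f : Fin n → Prog d m α} {v : Fin n → α}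
    (h : ∀ i, Always P (fun b => b = v i) (f i)) : Always P (fun r => r = v) (collect f) := by
  induction n with
  | zero => exact Subsingleton.elim _ _
  | succ n ih =>
    refine (h 0).bind fun a ha => (ih fun i => h i.succ).bind fun r hr => ?_
    subst ha hr
    exact Fin.cons_self_tail v

theorem cost_collect_le {n : ℕ} {f : Fin n → Prog d m α} {c : ℕ}
    (h : ∀ i, (f i).cost P ≤ c) : (collect f).cost P ≤ n * c := by
  induction n with
  | zero => simp [collect, pure, cost]
  | succ n ih =>
    rw [show (n + 1) * c = c + n * c by ring]
    refine cost_bind_le (h 0) (always_of_forall (fun a => ?_) _)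
    exact cost_bind_le (c := 0) (ih fun i => h i.succ) (always_of_forall (fun r => le_rfl) _)

end Prog

/-! ### Strongly convex minimization -/

section Prox

variable {E : Type} [NormedAddCommGroup E] [InnerProductSpace ℝ E] {D : Set E} {G : E → ℝ}

/-- A convex function with closed epigraph has an affine minorant. -/
theorem exists_affine_minorant (hG : ConvexOn ℝ D G)
    (hcl : IsClosed {q : E × ℝ | q.1 ∈ D ∧ G q.1 ≤ q.2}) (hD : D.Nonempty) :
    ∃ (l : E →L[ℝ] ℝ) (b : ℝ), ∀ y ∈ D, l y + b ≤ G y := by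
  obtain ⟨x₀, hx₀⟩ := hD
  -- A point strictly below the graph is separated from the epigraph. The graph point directly above
  -- it then forces the vertical coefficient `Λ (0, 1)` to be positive.
  obtain ⟨Λ, u, h1, h2⟩ := geometric_hahn_banach_point_closed hG.convex_epigraph hcl
    (x := (x₀, G x₀ - 1)) (by simp)
  have hdec : ∀ y r, Λ (y, r) = Λ (y, 0) + r * Λ (0, 1) := by
    intro y r
    have : ((y, r) : E × ℝ) = (y, 0) + r • (0, 1) := by simp
    rw [this, map_add, map_smul, smul_eq_mul]
  have h3 := h2 (x₀, G x₀) ⟨hx₀, le_rfl⟩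
  rw [hdec] at h1 h3
  have hc : 0 < Λ (0, 1) := by linarith
  refine ⟨-(Λ (0, 1))⁻¹ • Λ.comp (.inl ℝ E ℝ), (Λ (0, 1))⁻¹ * u, fun y hy => ?_⟩
  have h4 := h2 (y, G y) ⟨hy, le_rfl⟩
  rw [hdec] at h4
  have h5 : (Λ (0, 1))⁻¹ * u ≤ (Λ (0, 1))⁻¹ * (Λ (y, 0) + G y * Λ (0, 1)) := by gcongr
  have h6 : (Λ (0, 1))⁻¹ * (Λ (y, 0) + G y * Λ (0, 1)) = (Λ (0, 1))⁻¹ * Λ (y, 0) + G y := by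
    field_simp
  simp only [_root_.smul_apply, ContinuousLinearMap.comp_apply,
    ContinuousLinearMap.inl_apply, smul_eq_mul]
  linarith

/-- A closed convex function plus a multiple of a squared distance has a minimizer. -/
theorem exists_prox [FiniteDimensional ℝ E] (hG : ConvexOn ℝ D G)
    (hcl : IsClosed {q : E × ℝ | q.1 ∈ D ∧ G q.1 ≤ q.2}) (hD : D.Nonempty) {c : ℝ} (hc : 0 < c)
    (v : E) : ∃ u ∈ D, ∀ y ∈ D, G u + c * ‖u - v‖ ^ 2 ≤ G y + c * ‖y - v‖ ^ 2 := by
  obtain ⟨l, b, hl⟩ := exists_affine_minorant hG hcl hD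
  obtain ⟨x₀, hx₀⟩ := hD
  set M := G x₀ + c * ‖x₀ - v‖ ^ 2 with hM
  -- The minimization runs over pairs (y, r) of the epigraph: G need not be continuous, but r + c‖y
  -- - v‖² is, and its sublevel set in the closed epigraph is compact.
  set T : Set (E × ℝ) := {q | q.1 ∈ D ∧ G q.1 ≤ q.2} ∩ {q | q.2 + c * ‖q.1 - v‖ ^ 2 ≤ M} with hT
  set A := ‖l‖
  have hA : 0 ≤ A := norm_nonneg l
  -- Beyond this radius the quadratic outweighs the affine minorant and the value exceeds M.
  set R := (A + |M - l v - b|) / c + 1 with hR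
  have hTcl : IsClosed T :=
    hcl.inter (isClosed_le (by fun_prop) continuous_const)
  have hll : ∀ y, l v - A * ‖y - v‖ ≤ l y := by
    intro y
    have h1 := l.le_opNorm (y - v)
    have h2 := neg_abs_le (l (y - v))
    rw [Real.norm_eq_abs] at h1
    rw [map_sub] at h1 h2
    linarith
  have hTb : T ⊆ Metric.closedBall v R ×ˢ Set.Icc (l v - A * R + b) M := by
    rintro ⟨y, r⟩ ⟨⟨hy, hyr⟩, hr⟩
    simp only [Set.mem_ofPred_eq] at hy hyr hr
    have h1 := hl y hy
    have h2 := hll y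
    have hyR : ‖y - v‖ ≤ R := by
      by_contra hcon
      push Not at hcon
      have hR1 : 1 ≤ R := by rw [hR]; linarith [show 0 ≤ (A + |M - l v - b|) / c by positivity]
      have h3 : c * R = A + |M - l v - b| + c := by rw [hR]; field_simp
      have h4 : c * R < c * ‖y - v‖ := by gcongr
      have h5 := le_abs_self (M - l v - b)
      have h6 := abs_nonneg (M - l v - b)
      have h7 : |M - l v - b| + c ≤ ‖y - v‖ * (c * ‖y - v‖ - A) := by
        have : 1 * (|M - l v - b| + c) ≤ ‖y - v‖ * (c * ‖y - v‖ - A) := by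
          apply mul_le_mul <;> linarith
        linarith
      nlinarith
    refine ⟨by simpa [dist_eq_norm] using hyR, ?_, ?_⟩
    · have : A * ‖y - v‖ ≤ A * R := by gcongr
      simp only
      linarith
    · have : 0 ≤ c * ‖y - v‖ ^ 2 := by positivity
      simp only
      linarith
  have hTc : IsCompact T :=
    ((isCompact_closedBall v R).prod isCompact_Icc).of_isClosed_subset hTcl hTb
  obtain ⟨⟨u, r⟩, ⟨⟨hu, hur⟩, hr⟩, hmin⟩ := hTc.exists_isMinOn
    ⟨(x₀, G x₀), ⟨hx₀, le_rfl⟩, show G x₀ + c * ‖x₀ - v‖ ^ 2 ≤ M from hM.ge⟩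
    (f := fun q : E × ℝ => q.2 + c * ‖q.1 - v‖ ^ 2) (by fun_prop)
  simp only [Set.mem_ofPred_eq] at hu hur hr
  refine ⟨u, hu, fun y hy => ?_⟩
  by_cases hyM : G y + c * ‖y - v‖ ^ 2 ≤ M
  · have := hmin (show (y, G y) ∈ T from ⟨⟨hy, le_rfl⟩, hyM⟩)
    simp only [Set.mem_ofPred_eq] at this
    linarith
  · linarith

/-- Stands in for the limit s → 0 in optimality arguments along a segment, where strong convexity
leaves the factor 1 - s after division by s. -/
theorem le_of_forall_one_sub_mul {a b c : ℝ}
    (h : ∀ s, 0 < s → s < 1 → a + (1 - s) * b ≤ c) : a + b ≤ c := by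
  by_contra! hcon
  rcases le_or_gt b 0 with hb | hb
  · linarith [h (1 / 2) (by norm_num) (by norm_num)]
  · set s := min (1 / 2) ((a + b - c) / (2 * b)) with hs
    have h1 : 0 < s := lt_min (by norm_num) (div_pos (by linarith) (by linarith))
    have h2 : s ≤ 1 / 2 := min_le_left _ _
    have h3 : s ≤ (a + b - c) / (2 * b) := min_le_right _ _
    rw [le_div_iff₀ (by linarith)] at h3
    have := h s h1 (by linarith)
    linarith

/-- Quadratic growth at the minimizer of a convex function plus a multiple of a squared
distance. -/
theorem prox_growth (hG : ConvexOn ℝ D G) {c : ℝ} {u v : E} (hu : u ∈ D)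
    (hmin : ∀ y ∈ D, G u + c * ‖u - v‖ ^ 2 ≤ G y + c * ‖y - v‖ ^ 2) {y : E} (hy : y ∈ D) :
    G u + c * ‖u - v‖ ^ 2 + c * ‖y - u‖ ^ 2 ≤ G y + c * ‖y - v‖ ^ 2 := by
  refine le_of_forall_one_sub_mul fun s hs0 hs1 => ?_
  have h1 := hG.2 hu hy (show 0 ≤ 1 - s by linarith) hs0.le (by ring)
  have h2 := hmin _ (hG.1 hu hy (show 0 ≤ 1 - s by linarith) hs0.le (by ring))
  have h3 : ‖(1 - s) • u + s • y - v‖ ^ 2 =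
      (1 - s) * ‖u - v‖ ^ 2 + s * ‖y - v‖ ^ 2 - s * (1 - s) * ‖y - u‖ ^ 2 := by
    have e1 : (1 - s) • u + s • y - v = (1 - s) • (u - v) + s • (y - v) := by module
    have e2 : y - u = (y - v) - (u - v) := by abel
    rw [e1, e2]
    generalize u - v = a
    generalize y - v = b
    rw [norm_add_sq_real, norm_sub_sq_real, norm_smul, norm_smul, inner_smul_left,
      inner_smul_right, mul_pow, mul_pow, Real.norm_eq_abs, Real.norm_eq_abs, sq_abs, sq_abs,
      real_inner_comm a b]
    simp only [conj_trivial]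
    ring
  rw [h3] at h2
  simp only [smul_eq_mul] at h1
  have h4 : s * (G u + c * ‖u - v‖ ^ 2 + (1 - s) * (c * ‖y - u‖ ^ 2)) ≤
      s * (G y + c * ‖y - v‖ ^ 2) := by nlinarith
  exact le_of_mul_le_mul_left h4 hs0

end Prox

theorem argmin_spec {X : Type} [Nonempty X] {f : X → EReal} (h : ∃ z, ∀ y, f z ≤ f y) (y : X) :
    f (argmin f) ≤ f y :=
  Classical.epsilon_spec h y

/-! ### The nonsmooth part `g`: real values on its domain and minimization over it. -/

namespace Problem

variable {d m : ℕ} (P : Problem d m)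

/-- The domain of `g`. -/
def dom : Set (Vec d) := {x | P.g x ≠ ⊤}

/-- The real values of `g` on its domain. -/
def gR (x : Vec d) : ℝ := (P.g x).toReal

variable {P} {L β B : ℝ}

theorem Assumptions.coe_gR (h : P.Assumptions L β B) {x : Vec d} (hx : x ∈ P.dom) :
    P.g x = (P.gR x : EReal) :=
  (EReal.coe_toReal hx (h.g_ne_bot x)).symm

theorem Assumptions.epigraph_eq (h : P.Assumptions L β B) :
    {p : Vec d × ℝ | P.g p.1 ≤ (p.2 : EReal)} = {q | q.1 ∈ P.dom ∧ P.gR q.1 ≤ q.2} := by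
  ext ⟨x, r⟩
  simp only [Set.mem_ofPred_eq]
  constructor
  · intro hx
    have hd : x ∈ P.dom := ne_top_of_le_ne_top (EReal.coe_ne_top r) hx
    exact ⟨hd, by rwa [h.coe_gR hd, EReal.coe_le_coe_iff] at hx⟩
  · rintro ⟨hd, hx⟩
    rwa [h.coe_gR hd, EReal.coe_le_coe_iff]

theorem Assumptions.convexOn_gR (h : P.Assumptions L β B) : ConvexOn ℝ P.dom P.gR := by
  rw [convexOn_iff_convex_epigraph, ← h.epigraph_eq]
  exact h.g_convex

/-- Minimizing `g` plus a convex function plus a multiple of a squared distance. -/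
theorem Assumptions.argmin_growth (h : P.Assumptions L β B) {q : Vec d → ℝ} (hqc : Continuous q)
    (hq : ConvexOn ℝ Set.univ q) {c : ℝ} (hc : 0 < c) (v : Vec d) {f : Vec d → EReal}
    (hf : ∀ z, f z = P.g z + ((q z + c * ‖z - v‖ ^ 2 : ℝ) : EReal)) :
    argmin f ∈ P.dom ∧ ∀ y ∈ P.dom,
      P.gR (argmin f) + q (argmin f) + c * ‖argmin f - v‖ ^ 2 + c * ‖y - argmin f‖ ^ 2
        ≤ P.gR y + q y + c * ‖y - v‖ ^ 2 := by
  have hconv : ConvexOn ℝ P.dom (fun z => P.gR z + q z) :=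
    h.convexOn_gR.add (hq.subset (Set.subset_univ _) h.convexOn_gR.1)
  have hcl : IsClosed {p : Vec d × ℝ | p.1 ∈ P.dom ∧ P.gR p.1 + q p.1 ≤ p.2} := by
    have h1 := h.g_closed
    rw [h.epigraph_eq] at h1
    -- The epigraph of `gR + q` is the preimage of that of `gR` under the continuous shear (z, t) ↦
    -- (z, t - q z).
    have h2 := h1.preimage (f := fun p : Vec d × ℝ => (p.1, p.2 - q p.1)) (by fun_prop)
    convert h2 using 1
    ext p
    simp [le_sub_iff_add_le]
  have hval : ∀ z ∈ P.dom, f z = ((P.gR z + q z + c * ‖z - v‖ ^ 2 : ℝ) : EReal) := by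
    intro z hz
    rw [hf, h.coe_gR hz, ← EReal.coe_add, add_assoc]
  have htop : ∀ z, z ∉ P.dom → f z = ⊤ := by
    intro z hz
    rw [hf, not_not.1 hz, EReal.top_add_coe]
  obtain ⟨u, hu, humin⟩ := exists_prox hconv hcl h.g_proper hc v
  have hex : ∃ z, ∀ y, f z ≤ f y := by
    refine ⟨u, fun y => ?_⟩
    by_cases hy : y ∈ P.dom
    · rw [hval u hu, hval y hy, EReal.coe_le_coe_iff]
      exact humin y hy
    · rw [htop y hy]; exact le_top
  have hsp := argmin_spec hex
  have hdom : argmin f ∈ P.dom := by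
    by_contra hcon
    have := hsp u
    rw [htop _ hcon, hval u hu] at this
    exact EReal.coe_ne_top _ (top_le_iff.1 this)
  refine ⟨hdom, fun y hy => prox_growth hconv hdom (fun y hy => ?_) hy⟩
  have := hsp y
  rwa [hval _ hdom, hval y hy, EReal.coe_le_coe_iff] at this

theorem Assumptions.proxG_spec (h : P.Assumptions L β B) {t : ℝ} (ht : 0 < t) (v : Vec d) :
    P.proxG t v ∈ P.dom ∧ ∀ y ∈ P.dom,
      P.gR (P.proxG t v) + 1 / (2 * t) * ‖P.proxG t v - v‖ ^ 2
          + 1 / (2 * t) * ‖y - P.proxG t v‖ ^ 2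
        ≤ P.gR y + 1 / (2 * t) * ‖y - v‖ ^ 2 := by
  have := h.argmin_growth (q := fun _ => 0) continuous_const (convexOn_const 0 convex_univ)
    (c := 1 / (2 * t)) (by positivity) v
    (f := fun z : Vec d => P.g z + ((1 / (2 * t) * ‖z - v‖ ^ 2 : ℝ) : EReal)) (fun z => by simp)
  simp only [add_zero] at this
  exact this

/-! ### The Moreau envelope of `hᵢ` -/

/-- The value at `s` of the Moreau envelope of `hᵢ`. -/
def env (P : Problem d m) (i : Fin m) (r s : ℝ) : ℝ :=
  P.h i (P.proxH i r s) + 1 / (2 * r) * (P.proxH i r s - s) ^ 2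

/-- The derivative of the Moreau envelope of `hᵢ`. -/
def denv (P : Problem d m) (i : Fin m) (r s : ℝ) : ℝ := 1 / r * (s - P.proxH i r s)

theorem Assumptions.continuous_h (h : P.Assumptions L β B) (i : Fin m) : Continuous (P.h i) := by
  have : LipschitzWith (Real.toNNReal L) (P.h i) := by
    refine LipschitzWith.of_dist_le_mul fun s t => ?_
    rw [Real.dist_eq, Real.dist_eq]
    exact (h.h_lip i s t).trans
      (mul_le_mul_of_nonneg_right (Real.le_coe_toNNReal L) (abs_nonneg _))
  exact this.continuous

theorem Assumptions.proxH_spec (h : P.Assumptions L β B) (i : Fin m) {r : ℝ} (hr : 0 < r)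
    (s y : ℝ) :
    P.h i (P.proxH i r s) + 1 / (2 * r) * (P.proxH i r s - s) ^ 2
        + 1 / (2 * r) * (y - P.proxH i r s) ^ 2
      ≤ P.h i y + 1 / (2 * r) * (y - s) ^ 2 := by
  have hcl : IsClosed {q : ℝ × ℝ | q.1 ∈ Set.univ ∧ P.h i q.1 ≤ q.2} := by
    have := h.continuous_h i
    simp only [Set.mem_univ, true_and]
    exact isClosed_le (by fun_prop) (by fun_prop)
  have hc : 0 < 1 / (2 * r) := by positivity
  obtain ⟨u, -, hu⟩ := exists_prox (h.h_convex i) hcl ⟨0, trivial⟩ hc s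
  simp only [Real.norm_eq_abs, sq_abs] at hu
  have hsp := argmin_spec (X := ℝ)
    (f := fun u : ℝ => ((P.h i u + 1 / (2 * r) * (u - s) ^ 2 : ℝ) : EReal))
    ⟨u, fun y => EReal.coe_le_coe_iff.2 (hu y trivial)⟩
  have := prox_growth (h.h_convex i) (c := 1 / (2 * r)) (u := P.proxH i r s) (v := s) trivial
    (fun y _ => by
      simp only [Real.norm_eq_abs, sq_abs]
      exact EReal.coe_le_coe_iff.1 (hsp y)) (y := y) trivial
  simpa only [Real.norm_eq_abs, sq_abs] using this

/-- The three squares of `proxH_spec` combine exactly into a linear term: the envelope's derivative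
at s is a subgradient of hᵢ at the prox point of s. -/
theorem Assumptions.denv_subgradient (h : P.Assumptions L β B) (i : Fin m) {r : ℝ} (hr : 0 < r)
    (s y : ℝ) :
    P.h i (P.proxH i r s) + P.denv i r s * (y - P.proxH i r s) ≤ P.h i y := by
  have h1 := h.proxH_spec i hr s y
  set u := P.proxH i r s
  have h2 : P.denv i r s * (y - u) =
      1 / (2 * r) * (u - s) ^ 2 + 1 / (2 * r) * (y - u) ^ 2 - 1 / (2 * r) * (y - s) ^ 2 := by
    change 1 / r * (s - u) * (y - u) = _
    field_simp
    ring
  linarith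

/-- Exact algebra on the subgradient inequality between the prox points of s and t. The result
encodes convexity and 1/r-smoothness of the envelope at once, in the cocoercive form that the
variance bounds need. -/
theorem Assumptions.env_lower (h : P.Assumptions L β B) (i : Fin m) {r : ℝ} (hr : 0 < r)
    (s t : ℝ) :
    P.env i r s + P.denv i r s * (t - s) + r / 2 * (P.denv i r t - P.denv i r s) ^ 2
      ≤ P.env i r t := by
  have h1 := h.denv_subgradient i hr s (P.proxH i r t)
  simp only [env, denv] at *
  set u := P.proxH i r s
  set w := P.proxH i r t
  have h2 : 1 / (2 * r) * (u - s) ^ 2 + 1 / r * (s - u) * (t - s)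
      + r / 2 * (1 / r * (t - w) - 1 / r * (s - u)) ^ 2
      = 1 / (2 * r) * (w - t) ^ 2 + 1 / r * (s - u) * (w - u) := by
    field_simp
    ring
  linarith

/-- A subgradient of an L-Lipschitz function is at most L in absolute value; it is tested at unit
distance on both sides of the prox point. -/
theorem Assumptions.abs_denv_le (h : P.Assumptions L β B) (i : Fin m) {r : ℝ} (hr : 0 < r)
    (s : ℝ) : |P.denv i r s| ≤ L := by
  set u := P.proxH i r s
  have h1 := h.denv_subgradient i hr s (u + 1)
  have h2 := h.denv_subgradient i hr s (u - 1)
  have h3 := (le_abs_self _).trans (h.h_lip i (u + 1) u)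
  have h4 := (le_abs_self _).trans (h.h_lip i (u - 1) u)
  rw [show P.proxH i r s = u from rfl] at h1 h2
  rw [show u - 1 - u = -1 by ring] at h2 h4
  rw [show u + 1 - u = 1 by ring] at h1 h3
  rw [abs_one] at h3
  rw [abs_neg, abs_one] at h4
  rw [abs_le]
  constructor <;> linarith

theorem Assumptions.env_le (h : P.Assumptions L β B) (i : Fin m) {r : ℝ} (hr : 0 < r) (s : ℝ) :
    P.env i r s ≤ P.h i s := by
  have h1 := h.proxH_spec i hr s s
  have : 0 ≤ 1 / (2 * r) * (s - P.proxH i r s) ^ 2 := by positivity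
  simp only [sub_self, env] at *
  linarith

/-- Moving from s to its prox point u costs at most L|s - u|, and Young's inequality splits this
into the quadratic of the envelope and rL²/2. -/
theorem Assumptions.le_env_add (h : P.Assumptions L β B) (i : Fin m) {r : ℝ} (hr : 0 < r)
    (s : ℝ) : P.h i s ≤ P.env i r s + r * L ^ 2 / 2 := by
  have h1 := (le_abs_self _).trans (h.h_lip i s (P.proxH i r s))
  rw [env]
  set u := P.proxH i r s
  have h2 : L * |s - u| ≤ 1 / (2 * r) * (u - s) ^ 2 + r * L ^ 2 / 2 := by
    rw [← sq_abs (u - s), abs_sub_comm u s]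
    set a := |s - u|
    have h3 : 1 / (2 * r) * a ^ 2 + r * L ^ 2 / 2 - L * a = 1 / (2 * r) * (a - r * L) ^ 2 := by
      field_simp
      ring
    have h4 : 0 ≤ 1 / (2 * r) * (a - r * L) ^ 2 := by positivity
    linarith
  linarith

theorem Assumptions.env_lip (h : P.Assumptions L β B) (i : Fin m) {r : ℝ} (hr : 0 < r)
    (s t : ℝ) : P.env i r s - P.env i r t ≤ L * |s - t| := by
  have h1 := h.env_lower i hr s t
  have h2 : 0 ≤ r / 2 * (P.denv i r t - P.denv i r s) ^ 2 := by positivity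
  have h3 : P.denv i r s * (s - t) ≤ L * |s - t| :=
    (le_abs_self _).trans (by
      rw [abs_mul]
      exact mul_le_mul_of_nonneg_right (h.abs_denv_le i hr s) (abs_nonneg _))
  linarith

/-! ### The linearization of `cᵢ` -/

theorem Assumptions.abs_linearization_le (h : P.Assumptions L β B) (i : Fin m) (x z : Vec d) :
    |P.c i z - (P.c i x + ⟪∇ (P.c i) x, z - x⟫_ℝ)| ≤ β / 2 * ‖z - x‖ ^ 2 := by
  have hd : Differentiable ℝ (P.c i) := (h.c_smooth i).differentiable (by norm_num)
  set v := z - x with hv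
  have hψ : ∀ s : ℝ, HasDerivAt (fun s : ℝ => P.c i (x + s • v) - P.c i x - s * ⟪∇ (P.c i) x, v⟫_ℝ)
      (⟪∇ (P.c i) (x + s • v) - ∇ (P.c i) x, v⟫_ℝ) s := by
    intro s
    have h1 : HasDerivAt (fun s : ℝ => x + s • v) v s := by
      simpa using ((hasDerivAt_id s).smul_const v).const_add x
    have h2 := (hd (x + s • v)).hasGradientAt.hasFDerivAt.comp_hasDerivAt s h1
    have h3 := (h2.sub_const (P.c i x)).sub
      ((hasDerivAt_id s).mul_const ⟪∇ (P.c i) x, v⟫_ℝ)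
    rw [inner_sub_left]
    refine h3.congr_deriv ?_
    simp
  have hB : ∀ s : ℝ, HasDerivAt (fun s : ℝ => β / 2 * ‖v‖ ^ 2 * s ^ 2) (β * ‖v‖ ^ 2 * s) s := by
    intro s
    have := ((hasDerivAt_id s).pow 2).const_mul (β / 2 * ‖v‖ ^ 2)
    refine this.congr_deriv ?_
    simp
    ring
  -- The Taylor remainder along the segment vanishes at 0 and has derivative at most β s ‖v‖², so it
  -- stays below the quadratic with that derivative.
  have key := image_norm_le_of_norm_deriv_right_le_deriv_boundary
    (f := fun s : ℝ => P.c i (x + s • v) - P.c i x - s * ⟪∇ (P.c i) x, v⟫_ℝ) (a := 0) (b := 1)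
    (fun s _ => (hψ s).continuousAt.continuousWithinAt)
    (fun s _ => (hψ s).hasDerivWithinAt) (B := fun s : ℝ => β / 2 * ‖v‖ ^ 2 * s ^ 2)
    (by simp) hB (fun s hs => by
      have h1 := h.c_lip i (x + s • v) x
      rw [add_sub_cancel_left, norm_smul, Real.norm_eq_abs, abs_of_nonneg hs.1] at h1
      refine (norm_inner_le_norm _ _).trans ?_
      calc _ ≤ β * (s * ‖v‖) * ‖v‖ := by gcongr
        _ = _ := by ring)
    (x := 1) (by simp)
  simp only [one_smul, one_mul, Real.norm_eq_abs] at key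
  rw [show x + v = z by simp [hv]] at key
  rw [← sub_sub]
  simpa using key

end Problem

/-! ### Averages over the index set -/

/-- The average of finitely many reals. -/
def avg {m : ℕ} (a : Fin m → ℝ) : ℝ := (1 / m : ℝ) * ∑ i, a i

section Avg

variable {m : ℕ} {E : Type} [NormedAddCommGroup E] [InnerProductSpace ℝ E]

theorem avg_mono {a b : Fin m → ℝ} (h : ∀ i, a i ≤ b i) : avg a ≤ avg b :=
  mul_le_mul_of_nonneg_left (Finset.sum_le_sum fun i _ => h i) (by positivity)

theorem avg_add (a b : Fin m → ℝ) : avg (fun i => a i + b i) = avg a + avg b := by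
  simp only [avg, Finset.sum_add_distrib, mul_add]

theorem avg_sub (a b : Fin m → ℝ) : avg (fun i => a i - b i) = avg a - avg b := by
  simp only [avg, Finset.sum_sub_distrib, mul_sub]

theorem avg_const_mul (r : ℝ) (a : Fin m → ℝ) : avg (fun i => r * a i) = r * avg a := by
  simp only [avg, ← Finset.mul_sum, mul_left_comm]

theorem avg_const (hm : 0 < m) (r : ℝ) : avg (fun _ : Fin m => r) = r := by
  have : (m : ℝ) ≠ 0 := by positivity
  simp [avg, this]

theorem avg_inner (a : Fin m → E) (w : E) :
    avg (fun i => ⟪a i, w⟫_ℝ) = ⟪(1 / m : ℝ) • ∑ i, a i, w⟫_ℝ := by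
  rw [avg, inner_smul_left, sum_inner]
  simp

theorem avg_norm_sub_mean_sq_le (hm : 0 < m) (a : Fin m → E) :
    avg (fun i => ‖a i - (1 / m : ℝ) • ∑ j, a j‖ ^ 2) ≤ avg (fun i => ‖a i‖ ^ 2) := by
  set c := (1 / m : ℝ) • ∑ j, a j with hc
  have h1 : (fun i => ‖a i - c‖ ^ 2) = fun i => (‖a i‖ ^ 2 - 2 * ⟪a i, c⟫_ℝ) + ‖c‖ ^ 2 := by
    funext i
    rw [norm_sub_sq_real]
  rw [h1, avg_add, avg_sub, avg_const_mul, avg_inner, ← hc, avg_const hm,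
    real_inner_self_eq_norm_sq]
  nlinarith [sq_nonneg ‖c‖]

end Avg

/-! ### Composite finite-sum minimization -/

/-- The data of `min_z (1/m) ∑ᵢ fᵢ(z) + p(z)`, with the gradients `gf i` of the `fᵢ`, the domain
`D` of `p`, the smoothness constant `ℓ` of the `fᵢ`, the strong convexity constant `μ` of `p`, and
the minimizer `xs`. -/
structure Composite (d m : ℕ) where
  f : Fin m → Vec d → ℝ
  gf : Fin m → Vec d → Vec d
  p : Vec d → ℝ
  D : Set (Vec d)
  ℓ : ℝ
  μ : ℝ
  xs : Vec d

namespace Composite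

variable {d m : ℕ} (Q : Composite d m)

/-- The average of the `fᵢ`. -/
def fbar (x : Vec d) : ℝ := avg fun i => Q.f i x

/-- The average of the gradients. -/
def gbar (x : Vec d) : Vec d := (1 / m : ℝ) • ∑ i, Q.gf i x

/-- The optimality gap. -/
def gap (x : Vec d) : ℝ := Q.fbar x + Q.p x - (Q.fbar Q.xs + Q.p Q.xs)

/-- The variance-reduced gradient estimator at `x` with the snapshot `xt`. -/
def est (xt x : Vec d) (i : Fin m) : Vec d := Q.gbar xt + (Q.gf i x - Q.gf i xt)

/-- The `fᵢ` are convex and `ℓ`-smooth, expressed by the cocoercivity of their gradients. -/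
structure Smooth : Prop where
  m_pos : 0 < m
  ℓ_pos : 0 < Q.ℓ
  lower : ∀ i w z, Q.f i w + ⟪Q.gf i w, z - w⟫_ℝ
    + 1 / (2 * Q.ℓ) * ‖Q.gf i z - Q.gf i w‖ ^ 2 ≤ Q.f i z

/-- The standing assumptions on a composite problem. -/
structure Valid : Prop extends Q.Smooth where
  μ_pos : 0 < Q.μ
  p_convex : ConvexOn ℝ Q.D Q.p
  xs_mem : Q.xs ∈ Q.D
  opt : ∀ y ∈ Q.D, Q.p Q.xs + Q.μ / 2 * ‖y - Q.xs‖ ^ 2 ≤ Q.p y + ⟪Q.gbar Q.xs, y - Q.xs⟫_ℝ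

/-- `u = prox_{ηp}(x - ηv)`, expressed by the resulting three-point inequality. -/
def IsProxStep (η : ℝ) (x v u : Vec d) : Prop :=
  u ∈ Q.D ∧ ∀ y ∈ Q.D, Q.p u + ⟪v, u - x⟫_ℝ + 1 / (2 * η) * ‖u - x‖ ^ 2
      + (1 / (2 * η) + Q.μ / 2) * ‖y - u‖ ^ 2
    ≤ Q.p y + ⟪v, y - x⟫_ℝ + 1 / (2 * η) * ‖y - x‖ ^ 2

variable {Q}

namespace Smooth

theorem fbar_lower (hQ : Q.Smooth) (w z : Vec d) : Q.fbar w + ⟪Q.gbar w, z - w⟫_ℝ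
    + 1 / (2 * Q.ℓ) * avg (fun i => ‖Q.gf i z - Q.gf i w‖ ^ 2) ≤ Q.fbar z := by
  have h := avg_mono fun i => hQ.lower i w z
  rwa [avg_add, avg_add, avg_inner, avg_const_mul] at h

theorem fbar_linear (hQ : Q.Smooth) (w z : Vec d) : Q.fbar w + ⟪Q.gbar w, z - w⟫_ℝ ≤ Q.fbar z := by
  have h := hQ.fbar_lower w z
  have hl := hQ.ℓ_pos
  have : 0 ≤ 1 / (2 * Q.ℓ) * avg (fun i => ‖Q.gf i z - Q.gf i w‖ ^ 2) := by
    unfold avg; positivity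
  linarith

theorem f_upper (hQ : Q.Smooth) (i : Fin m) (w z : Vec d) :
    Q.f i z ≤ Q.f i w + ⟪Q.gf i w, z - w⟫_ℝ + Q.ℓ / 2 * ‖z - w‖ ^ 2 := by
  have h := hQ.lower i z w
  have hl := hQ.ℓ_pos
  set a := Q.gf i z
  set b := Q.gf i w
  have h1 : ⟪a, w - z⟫_ℝ = -⟪b, z - w⟫_ℝ - ⟪a - b, z - w⟫_ℝ := by
    rw [inner_sub_left, ← neg_sub z w, inner_neg_right]; ring
  have h2 : 0 ≤ 1 / (2 * Q.ℓ) * ‖Q.ℓ • (z - w) - (a - b)‖ ^ 2 := by positivity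
  have h3 : 1 / (2 * Q.ℓ) * ‖Q.ℓ • (z - w) - (a - b)‖ ^ 2 =
      Q.ℓ / 2 * ‖z - w‖ ^ 2 - ⟪a - b, z - w⟫_ℝ + 1 / (2 * Q.ℓ) * ‖b - a‖ ^ 2 := by
    rw [norm_sub_sq_real, norm_smul, inner_smul_left, mul_pow, Real.norm_eq_abs, sq_abs,
      norm_sub_rev b a, real_inner_comm (a - b) (z - w)]
    simp only [conj_trivial]
    field_simp
  linarith

theorem fbar_upper (hQ : Q.Smooth) (w z : Vec d) :
    Q.fbar z ≤ Q.fbar w + ⟪Q.gbar w, z - w⟫_ℝ + Q.ℓ / 2 * ‖z - w‖ ^ 2 := by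
  have h := avg_mono fun i => hQ.f_upper i w z
  rwa [avg_add, avg_add, avg_inner, avg_const hQ.m_pos] at h

theorem fbar_convex (hQ : Q.Smooth) : ConvexOn ℝ Set.univ Q.fbar := by
  refine ⟨convex_univ, fun x _ y _ a b ha hb hab => ?_⟩
  have h1 := hQ.fbar_linear (a • x + b • y) x
  have h2 := hQ.fbar_linear (a • x + b • y) y
  set w := a • x + b • y with hw
  have h3 : a * ⟪Q.gbar w, x - w⟫_ℝ + b * ⟪Q.gbar w, y - w⟫_ℝ = 0 := by
    rw [← inner_smul_right, ← inner_smul_right, ← inner_add_right]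
    have : a • (x - w) + b • (y - w) = 0 := by
      rw [smul_sub, smul_sub, sub_add_sub_comm, ← add_smul, hab, one_smul, ← hw, sub_self]
    rw [this, inner_zero_right]
  simp only [smul_eq_mul]
  have h4 := mul_le_mul_of_nonneg_left h1 ha
  have h5 := mul_le_mul_of_nonneg_left h2 hb
  have h6 : a * Q.fbar w + b * Q.fbar w = Q.fbar w := by rw [← add_mul, hab, one_mul]
  linarith

end Smooth

namespace Valid

theorem growth (hQ : Q.Valid) {y : Vec d} (hy : y ∈ Q.D) : Q.μ / 2 * ‖y - Q.xs‖ ^ 2 ≤ Q.gap y := by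
  have h1 := hQ.opt y hy
  have h2 := hQ.fbar_linear Q.xs y
  rw [gap]
  linarith

theorem gap_nonneg (hQ : Q.Valid) {y : Vec d} (hy : y ∈ Q.D) : 0 ≤ Q.gap y := by
  have := hQ.μ_pos
  exact le_trans (by positivity) (hQ.growth hy)

theorem gap_convex (hQ : Q.Valid) : ConvexOn ℝ Q.D Q.gap :=
  ((hQ.fbar_convex.subset (Set.subset_univ _) hQ.p_convex.1).add hQ.p_convex).add_const
    (-(Q.fbar Q.xs + Q.p Q.xs))

/-- A full prox-gradient step with step size `1 / ℓ`. -/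
theorem proxGrad_step (hQ : Q.Valid) {x u : Vec d} (h : Q.IsProxStep (1 / Q.ℓ) x (Q.gbar x) u) :
    Q.gap u ≤ Q.ℓ / 2 * ‖x - Q.xs‖ ^ 2 := by
  have hl := hQ.ℓ_pos
  have hμ := hQ.μ_pos
  have h1 := h.2 Q.xs hQ.xs_mem
  have h2 := hQ.fbar_upper x u
  have h3 := hQ.fbar_linear x Q.xs
  rw [show 1 / (2 * (1 / Q.ℓ)) = Q.ℓ / 2 by field_simp, norm_sub_rev Q.xs x] at h1
  have h4 : 0 ≤ (Q.ℓ / 2 + Q.μ / 2) * ‖Q.xs - u‖ ^ 2 := by positivity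
  rw [gap]
  linarith

/-! #### Variance reduction -/

theorem avg_est_inner (hQ : Q.Valid) (xt x w : Vec d) : avg (fun i => ⟪Q.est xt x i, w⟫_ℝ) = ⟪Q.gbar x, w⟫_ℝ := by
  simp only [est, inner_add_left, inner_sub_left]
  rw [avg_add, avg_const hQ.m_pos, avg_sub, avg_inner, avg_inner]
  simp only [gbar]
  ring

/-- The estimator minus the full gradient is `gf i x - gf i xt` minus its mean over i, and a
variance is at most the second moment. -/
theorem avg_est_sub_sq_le (hQ : Q.Valid) (xt x : Vec d) :
    avg (fun i => ‖Q.est xt x i - Q.gbar x‖ ^ 2)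
      ≤ avg (fun i => ‖Q.gf i x - Q.gf i xt‖ ^ 2) := by
  have h := avg_norm_sub_mean_sq_le hQ.m_pos fun i => Q.gf i x - Q.gf i xt
  rw [Finset.sum_sub_distrib, smul_sub] at h
  refine le_trans (le_of_eq ?_) h
  congr 1
  funext i
  congr 2
  simp only [est, gbar]
  abel

/-- The variance bound for Katyusha: keeping the Bregman divergence, inner product included, lets it
cancel against the snapshot's share in the coupled point. -/
theorem avg_est_sub_sq_le_bregman (hQ : Q.Valid) (xt x : Vec d) :
    avg (fun i => ‖Q.est xt x i - Q.gbar x‖ ^ 2)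
      ≤ 2 * Q.ℓ * (Q.fbar xt - Q.fbar x - ⟪Q.gbar x, xt - x⟫_ℝ) := by
  have hl := hQ.ℓ_pos
  have h1 := hQ.avg_est_sub_sq_le xt x
  have h2 := hQ.fbar_lower x xt
  simp only [norm_sub_rev (Q.gf _ xt)] at h2
  set A := avg (fun i => ‖Q.gf i x - Q.gf i xt‖ ^ 2)
  have h3 : 2 * Q.ℓ * (1 / (2 * Q.ℓ) * A) ≤
      2 * Q.ℓ * (Q.fbar xt - Q.fbar x - ⟪Q.gbar x, xt - x⟫_ℝ) := by
    gcongr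
    linarith
  have h4 : 2 * Q.ℓ * (1 / (2 * Q.ℓ) * A) = A := by field_simp
  linarith

/-- Cocoercivity at `xs` bounds the left side by a Bregman divergence, which the optimality
condition bounds by the gap. -/
theorem avg_grad_sub_opt_sq_le (hQ : Q.Valid) {x : Vec d} (hx : x ∈ Q.D) :
    avg (fun i => ‖Q.gf i x - Q.gf i Q.xs‖ ^ 2) ≤ 2 * Q.ℓ * Q.gap x := by
  have hl := hQ.ℓ_pos
  have hμ := hQ.μ_pos
  have h2 := hQ.fbar_lower Q.xs x
  have h3 := hQ.opt x hx
  have h5 : 0 ≤ Q.μ / 2 * ‖x - Q.xs‖ ^ 2 := by positivity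
  set A := avg (fun i => ‖Q.gf i x - Q.gf i Q.xs‖ ^ 2)
  have h3 : 2 * Q.ℓ * (1 / (2 * Q.ℓ) * A) ≤ 2 * Q.ℓ * Q.gap x := by
    gcongr
    rw [gap]
    linarith
  have h4 : 2 * Q.ℓ * (1 / (2 * Q.ℓ) * A) = A := by field_simp
  linarith

/-- The variance bound for Prox-SVRG: passing through the gradients at the minimizer makes the noise
vanish as both gaps do. -/
theorem avg_est_sub_sq_le_gap (hQ : Q.Valid) {xt x : Vec d} (hxt : xt ∈ Q.D) (hx : x ∈ Q.D) :
    avg (fun i => ‖Q.est xt x i - Q.gbar x‖ ^ 2) ≤ 4 * Q.ℓ * (Q.gap x + Q.gap xt) := by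
  have h1 := hQ.avg_est_sub_sq_le xt x
  have h2 := hQ.avg_grad_sub_opt_sq_le hx
  have h3 := hQ.avg_grad_sub_opt_sq_le hxt
  have h4 : avg (fun i => ‖Q.gf i x - Q.gf i xt‖ ^ 2) ≤
      avg (fun i => 2 * ‖Q.gf i x - Q.gf i Q.xs‖ ^ 2 + 2 * ‖Q.gf i xt - Q.gf i Q.xs‖ ^ 2) := by
    refine avg_mono fun i => ?_
    have e : Q.gf i x - Q.gf i xt = (Q.gf i x - Q.gf i Q.xs) - (Q.gf i xt - Q.gf i Q.xs) := by abel
    rw [e]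
    generalize Q.gf i x - Q.gf i Q.xs = a
    generalize Q.gf i xt - Q.gf i Q.xs = b
    have := parallelogram_law_with_norm ℝ a b
    nlinarith [sq_nonneg ‖a + b‖]
  rw [avg_add, avg_const_mul, avg_const_mul] at h4
  linarith

/-! #### One step of Prox-SVRG -/

/-- The prox inequality is tested at the minimizer. The inner product of the estimator's error with
`xs - x` averages to zero because `x` does not depend on the drawn index. -/
theorem svrg_step (hQ : Q.Valid) {η : ℝ} (hη : 0 < η) (hηl : η * Q.ℓ ≤ 1 / 2) {xt x : Vec d} (hxt : xt ∈ Q.D)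
    (hx : x ∈ Q.D) {u : Fin m → Vec d} (hu : ∀ i, Q.IsProxStep η x (Q.est xt x i) (u i)) :
    avg (fun i => 2 * η * Q.gap (u i) + ‖u i - Q.xs‖ ^ 2)
      ≤ ‖x - Q.xs‖ ^ 2 + 8 * Q.ℓ * η ^ 2 * (Q.gap x + Q.gap xt) := by
  have hl := hQ.ℓ_pos
  have hμ := hQ.μ_pos
  have hpt : ∀ i, 2 * η * Q.gap (u i) + ‖u i - Q.xs‖ ^ 2 ≤
      ‖x - Q.xs‖ ^ 2 + 2 * η ^ 2 * ‖Q.est xt x i - Q.gbar x‖ ^ 2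
        + 2 * η * (⟪Q.est xt x i, Q.xs - x⟫_ℝ - ⟪Q.gbar x, Q.xs - x⟫_ℝ) := by
    intro i
    have h1 := (hu i).2 Q.xs hQ.xs_mem
    have h2 := hQ.fbar_upper x (u i)
    have h3 := hQ.fbar_linear x Q.xs
    have hg : Q.gap (u i) = Q.fbar (u i) + Q.p (u i) - (Q.fbar Q.xs + Q.p Q.xs) := rfl
    rw [norm_sub_rev Q.xs x, norm_sub_rev Q.xs (u i)] at h1
    set v := Q.est xt x i
    set e := u i - x
    have h4 : ⟪v, e⟫_ℝ - ⟪Q.gbar x, e⟫_ℝ = ⟪v - Q.gbar x, e⟫_ℝ := (inner_sub_left _ _ _).symm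
    -- Young's inequality spends half of ‖e‖² on the noise; the other half pays for the smoothness
    -- error, by η ℓ ≤ 1/2.
    have h5 : 0 ≤ ‖(2 * η) • (v - Q.gbar x) + e‖ ^ 2 := by positivity
    rw [norm_add_sq_real, norm_smul, inner_smul_left, mul_pow, Real.norm_eq_abs, sq_abs] at h5
    simp only [conj_trivial] at h5
    have h6 : 2 * η * (Q.p (u i) + ⟪v, e⟫_ℝ + 1 / (2 * η) * ‖e‖ ^ 2
        + (1 / (2 * η) + Q.μ / 2) * ‖u i - Q.xs‖ ^ 2) ≤
        2 * η * (Q.p Q.xs + ⟪v, Q.xs - x⟫_ℝ + 1 / (2 * η) * ‖x - Q.xs‖ ^ 2) := by gcongr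
    have h7 : 2 * η * (Q.p (u i) + ⟪v, e⟫_ℝ + 1 / (2 * η) * ‖e‖ ^ 2
        + (1 / (2 * η) + Q.μ / 2) * ‖u i - Q.xs‖ ^ 2) = 2 * η * (Q.p (u i) + ⟪v, e⟫_ℝ)
        + ‖e‖ ^ 2 + ‖u i - Q.xs‖ ^ 2 + η * Q.μ * ‖u i - Q.xs‖ ^ 2 := by field_simp; ring
    have h8 : 2 * η * (Q.p Q.xs + ⟪v, Q.xs - x⟫_ℝ + 1 / (2 * η) * ‖x - Q.xs‖ ^ 2) =
        2 * η * (Q.p Q.xs + ⟪v, Q.xs - x⟫_ℝ) + ‖x - Q.xs‖ ^ 2 := by field_simp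
    have h9 : 2 * η * (Q.fbar (u i) - Q.fbar Q.xs) ≤
        2 * η * (⟪Q.gbar x, e⟫_ℝ - ⟪Q.gbar x, Q.xs - x⟫_ℝ) + η * Q.ℓ * ‖e‖ ^ 2 := by
      have : 2 * η * (Q.fbar (u i) - Q.fbar Q.xs) ≤
        2 * η * (⟪Q.gbar x, e⟫_ℝ - ⟪Q.gbar x, Q.xs - x⟫_ℝ + Q.ℓ / 2 * ‖e‖ ^ 2) := by
        gcongr
        linarith
      linarith
    have h10 : η * Q.ℓ * ‖e‖ ^ 2 ≤ 1 / 2 * ‖e‖ ^ 2 := by gcongr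
    have h11 : 0 ≤ η * Q.μ * ‖u i - Q.xs‖ ^ 2 := by positivity
    rw [hg]
    nlinarith
  have h := avg_mono hpt
  rw [avg_add, avg_add (m := m) (fun i => _ + _), avg_add (m := m) (fun _ => ‖x - Q.xs‖ ^ 2),
    avg_const hQ.m_pos, avg_const_mul, avg_const_mul, avg_const_mul, avg_sub, hQ.avg_est_inner,
    avg_const hQ.m_pos, sub_self, mul_zero, add_zero] at h
  have h2 := hQ.avg_est_sub_sq_le_gap hxt hx
  rw [avg_add, avg_const_mul]
  have h3 : 2 * η ^ 2 * avg (fun i => ‖Q.est xt x i - Q.gbar x‖ ^ 2) ≤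
      2 * η ^ 2 * (4 * Q.ℓ * (Q.gap x + Q.gap xt)) := by gcongr
  linarith

/-! #### One step of Katyusha -/

/-- Linear coupling of a gradient step `y'` and a mirror step `z'`. Two choices of constants make it
close: a = 1/(3τℓ) matches the ‖z' - z‖² terms of the two steps, and the snapshot weight 1/2 matches
the factor 1/(4ℓ) · 2ℓ in front of the Bregman divergence that bounds the variance. -/
theorem katyusha_step (hQ : Q.Valid) {τ a : ℝ} (hτ : 0 < τ) (hτ2 : τ ≤ 1 / 2) (ha : a = 1 / (3 * τ * Q.ℓ))
    {xt y z x : Vec d} (hxt : xt ∈ Q.D) (hy : y ∈ Q.D)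
    (hx : x = τ • z + (1 / 2 : ℝ) • xt + (1 - τ - 1 / 2) • y) {y' z' : Fin m → Vec d}
    (hz' : ∀ i, Q.IsProxStep a z (Q.est xt x i) (z' i))
    (hy' : ∀ i, Q.IsProxStep (1 / (3 * Q.ℓ)) x (Q.est xt x i) (y' i)) :
    avg (fun i => a / τ * Q.gap (y' i) + (1 + a * Q.μ) / 2 * ‖z' i - Q.xs‖ ^ 2)
      ≤ a / τ * (1 / 2 * Q.gap xt + (1 / 2 - τ) * Q.gap y) + 1 / 2 * ‖z - Q.xs‖ ^ 2 := by
  have hl := hQ.ℓ_pos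
  have hμ := hQ.μ_pos
  have ha0 : 0 < a := by rw [ha]; positivity
  have hFs : ∀ w, Q.gap w = Q.fbar w + Q.p w - (Q.fbar Q.xs + Q.p Q.xs) := fun _ => rfl
  have hpt : ∀ i, a / τ * Q.gap (y' i) + (1 + a * Q.μ) / 2 * ‖z' i - Q.xs‖ ^ 2 ≤
      (a / τ * (Q.fbar x + 1 / 2 * Q.p xt + (1 / 2 - τ) * Q.p y - (Q.fbar Q.xs + Q.p Q.xs))
        + a * Q.p Q.xs + 1 / 2 * ‖z - Q.xs‖ ^ 2)
      + a / τ * (1 / (4 * Q.ℓ)) * ‖Q.est xt x i - Q.gbar x‖ ^ 2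
      + a * ⟪Q.est xt x i, Q.xs - z⟫_ℝ := by
    intro i
    set v := Q.est xt x i
    have h1 := (hz' i).2 Q.xs hQ.xs_mem
    -- The comparison point for `y'` is the coupled point with z replaced by z', so that w - x =
    -- τ(z' - z).
    set w := τ • z' i + (1 / 2 : ℝ) • xt + (1 - τ - 1 / 2) • y with hw
    have hw' : w = τ • z' i + (1 - τ) • ((1 / (2 * (1 - τ))) • xt
        + ((1 / 2 - τ) / (1 - τ)) • y) := by
      have : 1 - τ ≠ 0 := by linarith
      rw [hw, smul_add, smul_smul, smul_smul, add_assoc]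
      congr 3 <;> field_simp
      ring
    have hτ1 : 0 < 1 - τ := by linarith
    have hcoef : 1 / (2 * (1 - τ)) + (1 / 2 - τ) / (1 - τ) = 1 := by field_simp; ring
    have hc1 : 0 ≤ 1 / (2 * (1 - τ)) := by positivity
    have hc2 : 0 ≤ (1 / 2 - τ) / (1 - τ) := div_nonneg (by linarith) hτ1.le
    have hmid := hQ.p_convex.1 hxt hy hc1 hc2 hcoef
    have hwD : w ∈ Q.D := by
      rw [hw']
      exact hQ.p_convex.1 (hz' i).1 hmid hτ.le hτ1.le (by ring)
    have hpw : Q.p w ≤ τ * Q.p (z' i) + 1 / 2 * Q.p xt + (1 / 2 - τ) * Q.p y := by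
      have e1 := hQ.p_convex.2 (hz' i).1 hmid hτ.le hτ1.le (by ring)
      have e2 := hQ.p_convex.2 hxt hy hc1 hc2 hcoef
      rw [← hw'] at e1
      simp only [smul_eq_mul] at e1 e2
      have e3 := mul_le_mul_of_nonneg_left e2 hτ1.le
      have e4 : (1 - τ) * (1 / (2 * (1 - τ)) * Q.p xt + (1 / 2 - τ) / (1 - τ) * Q.p y) =
          1 / 2 * Q.p xt + (1 / 2 - τ) * Q.p y := by field_simp
      linarith
    have h2 := (hy' i).2 w hwD
    have hwx : w - x = τ • (z' i - z) := by rw [hw, hx]; module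
    rw [show 1 / (2 * (1 / (3 * Q.ℓ))) = 3 * Q.ℓ / 2 by field_simp, hwx, inner_smul_right,
      norm_smul, mul_pow, Real.norm_eq_abs, sq_abs] at h2
    have h3 := hQ.fbar_upper x (y' i)
    set e := y' i - x
    have h4 : ⟪v, e⟫_ℝ - ⟪Q.gbar x, e⟫_ℝ = ⟪v - Q.gbar x, e⟫_ℝ := (inner_sub_left _ _ _).symm
    -- The prox step supplies 3ℓ/2 ‖e‖² and smoothness consumes ℓ/2 ‖e‖²; the remaining ℓ‖e‖²
    -- absorbs the noise.
    have h5 : 0 ≤ 1 / (4 * Q.ℓ) * ‖(v - Q.gbar x) + (2 * Q.ℓ) • e‖ ^ 2 := by positivity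
    have h6 : 1 / (4 * Q.ℓ) * ‖(v - Q.gbar x) + (2 * Q.ℓ) • e‖ ^ 2 =
        1 / (4 * Q.ℓ) * ‖v - Q.gbar x‖ ^ 2 + ⟪v - Q.gbar x, e⟫_ℝ + Q.ℓ * ‖e‖ ^ 2 := by
      rw [norm_add_sq_real, norm_smul, inner_smul_right, mul_pow, Real.norm_eq_abs, sq_abs]
      field_simp
      ring
    have h7 : 0 ≤ (3 * Q.ℓ / 2 + Q.μ / 2) * ‖w - y' i‖ ^ 2 := by positivity
    have h8 : Q.gap (y' i) ≤ Q.fbar x + 1 / 2 * Q.p xt + (1 / 2 - τ) * Q.p y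
        - (Q.fbar Q.xs + Q.p Q.xs) + 1 / (4 * Q.ℓ) * ‖v - Q.gbar x‖ ^ 2
        + (τ * Q.p (z' i) + τ * ⟪v, z' i - z⟫_ℝ + 3 * Q.ℓ / 2 * (τ ^ 2 * ‖z' i - z‖ ^ 2)) := by
      rw [hFs]
      linarith
    have h9 : a / τ * Q.gap (y' i) ≤ a / τ * (Q.fbar x + 1 / 2 * Q.p xt + (1 / 2 - τ) * Q.p y
        - (Q.fbar Q.xs + Q.p Q.xs) + 1 / (4 * Q.ℓ) * ‖v - Q.gbar x‖ ^ 2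
        + (τ * Q.p (z' i) + τ * ⟪v, z' i - z⟫_ℝ + 3 * Q.ℓ / 2 * (τ ^ 2 * ‖z' i - z‖ ^ 2))) := by
      gcongr
    have h10 : a / τ * (τ * Q.p (z' i) + τ * ⟪v, z' i - z⟫_ℝ
        + 3 * Q.ℓ / 2 * (τ ^ 2 * ‖z' i - z‖ ^ 2)) =
        a * Q.p (z' i) + a * ⟪v, z' i - z⟫_ℝ + 1 / 2 * ‖z' i - z‖ ^ 2 := by
      rw [ha]; field_simp
    have h11 : a * (Q.p (z' i) + ⟪v, z' i - z⟫_ℝ + 1 / (2 * a) * ‖z' i - z‖ ^ 2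
        + (1 / (2 * a) + Q.μ / 2) * ‖Q.xs - z' i‖ ^ 2) ≤
        a * (Q.p Q.xs + ⟪v, Q.xs - z⟫_ℝ + 1 / (2 * a) * ‖Q.xs - z‖ ^ 2) := by gcongr
    rw [norm_sub_rev Q.xs z, norm_sub_rev Q.xs (z' i)] at h11
    have h12 : a * (Q.p (z' i) + ⟪v, z' i - z⟫_ℝ + 1 / (2 * a) * ‖z' i - z‖ ^ 2
        + (1 / (2 * a) + Q.μ / 2) * ‖z' i - Q.xs‖ ^ 2) = a * Q.p (z' i) + a * ⟪v, z' i - z⟫_ℝ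
        + 1 / 2 * ‖z' i - z‖ ^ 2 + (1 + a * Q.μ) / 2 * ‖z' i - Q.xs‖ ^ 2 := by field_simp
    have h13 : a * (Q.p Q.xs + ⟪v, Q.xs - z⟫_ℝ + 1 / (2 * a) * ‖z - Q.xs‖ ^ 2) =
        a * Q.p Q.xs + a * ⟪v, Q.xs - z⟫_ℝ + 1 / 2 * ‖z - Q.xs‖ ^ 2 := by field_simp
    rw [mul_add, mul_add, h10] at h9
    rw [h12, h13] at h11
    linarith
  have h := avg_mono hpt
  rw [avg_add (m := m) (fun i => _ + _) (fun i => a * ⟪Q.est xt x i, Q.xs - z⟫_ℝ),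
    avg_add (m := m) (fun _ => _) (fun i => _ * ‖Q.est xt x i - Q.gbar x‖ ^ 2),
    avg_const hQ.m_pos, avg_const_mul, avg_const_mul, hQ.avg_est_inner] at h
  have h1 := hQ.avg_est_sub_sq_le_bregman xt x
  have h2 : a / τ * (1 / (4 * Q.ℓ)) * avg (fun i => ‖Q.est xt x i - Q.gbar x‖ ^ 2) ≤
      a / τ * (1 / (4 * Q.ℓ)) * (2 * Q.ℓ * (Q.fbar xt - Q.fbar x - ⟪Q.gbar x, xt - x⟫_ℝ)) := by
    gcongr
  have h3 : a / τ * (1 / (4 * Q.ℓ)) * (2 * Q.ℓ * (Q.fbar xt - Q.fbar x - ⟪Q.gbar x, xt - x⟫_ℝ)) =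
      a / τ * (1 / 2 * (Q.fbar xt - Q.fbar x - ⟪Q.gbar x, xt - x⟫_ℝ)) := by field_simp; ring
  have h4 := hQ.fbar_linear x Q.xs
  have h5 := hQ.fbar_linear x y
  have h6 : τ * ⟪Q.gbar x, Q.xs - z⟫_ℝ = τ * ⟪Q.gbar x, Q.xs - x⟫_ℝ
      + 1 / 2 * ⟪Q.gbar x, xt - x⟫_ℝ + (1 / 2 - τ) * ⟪Q.gbar x, y - x⟫_ℝ := by
    simp only [← inner_smul_right, ← inner_add_right]
    congr 1
    rw [hx]
    module
  have h7 : a * ⟪Q.gbar x, Q.xs - z⟫_ℝ = a / τ * (τ * ⟪Q.gbar x, Q.xs - z⟫_ℝ) := by field_simp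
  have h8 : τ * ⟪Q.gbar x, Q.xs - z⟫_ℝ ≤ τ * (Q.fbar Q.xs - Q.fbar x)
      + 1 / 2 * ⟪Q.gbar x, xt - x⟫_ℝ + (1 / 2 - τ) * (Q.fbar y - Q.fbar x) := by
    rw [h6]
    have e1 : τ * ⟪Q.gbar x, Q.xs - x⟫_ℝ ≤ τ * (Q.fbar Q.xs - Q.fbar x) := by
      gcongr; linarith
    have e2 : (1 / 2 - τ) * ⟪Q.gbar x, y - x⟫_ℝ ≤ (1 / 2 - τ) * (Q.fbar y - Q.fbar x) :=
      mul_le_mul_of_nonneg_left (by linarith) (by linarith)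
    linarith
  have h9 : a / τ * (τ * ⟪Q.gbar x, Q.xs - z⟫_ℝ) ≤ a / τ * (τ * (Q.fbar Q.xs - Q.fbar x)
      + 1 / 2 * ⟪Q.gbar x, xt - x⟫_ℝ + (1 / 2 - τ) * (Q.fbar y - Q.fbar x)) := by gcongr
  have h10 : a * Q.p Q.xs = a / τ * (τ * Q.p Q.xs) := by field_simp
  rw [h3] at h2
  rw [h10, h7] at h
  rw [hFs xt, hFs y]
  linarith

end Valid

end Composite

/-! ### Running means -/

namespace Composite

variable {d m : ℕ} {Q : Composite d m}

/-- `s` is a weighted sum of points of the domain with total weight `A`. -/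
def IsWeightedSum (Q : Composite d m) (A : ℝ) (s : Vec d) : Prop :=
  (A = 0 ∧ s = 0) ∨ (0 < A ∧ A⁻¹ • s ∈ Q.D)

/-- Jensen's inequality, one summand at a time. For the empty sum the gap is taken at the
meaningless point `0⁻¹ • 0`, but with factor 0. -/
theorem IsWeightedSum.add (hQ : Q.Valid) {A w : ℝ} {s y : Vec d} (h : Q.IsWeightedSum A s)
    (hw : 0 < w) (hy : y ∈ Q.D) :
    Q.IsWeightedSum (A + w) (s + w • y) ∧
      (A + w) * Q.gap ((A + w)⁻¹ • (s + w • y)) ≤ A * Q.gap (A⁻¹ • s) + w * Q.gap y := by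
  rcases h with ⟨rfl, rfl⟩ | ⟨hA, hs⟩
  · have e : (0 + w)⁻¹ • (0 + w • y) = y := by
      rw [zero_add, zero_add, smul_smul, inv_mul_cancel₀ hw.ne', one_smul]
    refine ⟨Or.inr ⟨by linarith, by rwa [e]⟩, ?_⟩
    rw [e]
    simp
  · have hAw : 0 < A + w := by linarith
    have e : (A + w)⁻¹ • (s + w • y) = (A / (A + w)) • (A⁻¹ • s) + (w / (A + w)) • y := by
      rw [smul_smul, smul_add, smul_smul]
      congr 2 <;> field_simp
    have h1 : 0 ≤ A / (A + w) := by positivity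
    have h2 : 0 ≤ w / (A + w) := by positivity
    have h3 : A / (A + w) + w / (A + w) = 1 := by field_simp
    rw [e]
    refine ⟨Or.inr ⟨hAw, ?_⟩, ?_⟩
    · rw [e]
      exact hQ.gap_convex.1 hs hy h1 h2 h3
    · have h4 := mul_le_mul_of_nonneg_left (hQ.gap_convex.2 hs hy h1 h2 h3) hAw.le
      refine h4.trans (le_of_eq ?_)
      simp only [smul_eq_mul]
      field_simp

end Composite

/-! ### Prox-SVRG and Katyusha as programs: cost and expected progress. -/

open Prog

namespace Subproblem

variable {d m : ℕ} (S : Subproblem d m) (P : Problem d m)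

/-- The value of `∇fᵢ(z)`. -/
def gradV (i : Fin m) (z : Vec d) : Vec d :=
  (m / S.ν * (S.cval i + ⟪∇ (P.c i) S.x, z - S.x⟫_ℝ
    - P.proxH i (S.ν / m) (S.cval i + ⟪∇ (P.c i) S.x, z - S.x⟫_ℝ))) • S.cgrad i

/-- The value of `prox_{ηp}(v)`. -/
def proxpV (η : ℝ) (v : Vec d) : Vec d :=
  P.proxG (η * S.t / (η + S.t)) ((η + S.t)⁻¹ • (S.t • v + η • S.x))

/-- The subproblem `S` accesses the composite problem `Q`. -/
structure Represents (Q : Composite d m) : Prop where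
  valid : Q.Valid
  gf : ∀ i z, S.gradV P i z = Q.gf i z
  prox : ∀ η, 0 < η → ∀ x v, Q.IsProxStep η x v (S.proxpV P η (x - η • v))
  ℓ_eq : S.ℓ = Q.ℓ
  t_pos : 0 < S.t
  μ_eq : Q.μ = 1 / S.t
  one_le_κ : 1 ≤ S.κ

variable {S P} {Q : Composite d m}

theorem always_gradAll (z : Vec d) :
    Always P (fun r => r = fun i => S.gradV P i z) (S.gradAll z) :=
  always_collect fun _ => rfl

theorem cost_gradAll_le (z : Vec d) : (S.gradAll z).cost P ≤ m * 2 :=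
  cost_collect_le fun _ => le_rfl

theorem cost_proxGradStep_le (x : Vec d) :
    (S.proxGradStep x).cost P ≤ m * 2 + 1 :=
  cost_bind_le (cost_gradAll_le x) (always_of_forall (fun _ => le_rfl) _)

namespace Represents

theorem sum_gradV (R : S.Represents P Q) (z : Vec d) : (1 / m : ℝ) • ∑ i, S.gradV P i z = Q.gbar z := by
  simp only [R.gf, Composite.gbar]

theorem κ_mul_μ (R : S.Represents P Q) : S.κ * Q.μ = Q.ℓ := by
  have := R.t_pos
  rw [κ, R.μ_eq, R.ℓ_eq]
  field_simp

/-! #### The initial prox-gradient step -/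

theorem proxGradStep_spec (R : S.Represents P Q) (x : Vec d) :
    Always P (fun u => u ∈ Q.D ∧ Q.gap u ≤ Q.ℓ / 2 * ‖x - Q.xs‖ ^ 2) (S.proxGradStep x) := by
  refine (always_gradAll x).bind fun G hG => ?_
  have h := R.prox (1 / S.ℓ) (by rw [R.ℓ_eq]; exact one_div_pos.2 R.valid.ℓ_pos) x (Q.gbar x)
  subst hG
  rw [sum_gradV R]
  change _ ∈ Q.D ∧ _
  refine ⟨h.1, R.valid.proxGrad_step ?_⟩
  rw [← R.ℓ_eq]
  exact h

end Represents

/-! #### Prox-SVRG -/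

variable (S) in
/-- The inner step of Prox-SVRG. -/
def svrgStep (xt vt : Vec d) (s : Vec d × Vec d) : Prog d m (Vec d × Vec d) :=
  pick fun i => do
    let a ← S.gradf i s.1
    let b ← S.gradf i xt
    let y ← S.proxp (1 / (10 * S.ℓ)) (s.1 - (1 / (10 * S.ℓ)) • (vt + (a - b)))
    pure (y, s.2 + y)

theorem svrgEpoch_eq (xt : Vec d) :
    S.svrgEpoch xt = (S.gradAll xt >>= fun G =>
      loop (fun _ s => S.svrgStep xt ((1 / m : ℝ) • ∑ i, G i) s) (xt, 0) S.svrgJ >>= fun r =>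
      pure ((1 / S.svrgJ : ℝ) • r.2)) := rfl

theorem cost_svrgEpoch_le (xt : Vec d) :
    (S.svrgEpoch xt).cost P ≤ m * 2 + S.svrgJ * 5 := by
  rw [svrgEpoch_eq]
  refine cost_bind_le (cost_gradAll_le xt) (always_of_forall (fun G => ?_) _)
  refine cost_bind_le (b := S.svrgJ * 5) (c := 0) ?_ (always_of_forall (fun _ => le_rfl) _)
  refine cost_loop_le (fun _ _ => True) trivial
    (fun _ _ _ => always_of_forall (fun _ => trivial) _) (fun _ _ _ => ?_) _
  -- Two component gradients, each a dot product and a prox of hᵢ, and one prox of g.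
  exact Finset.sup_le fun _ _ => le_rfl

namespace Represents

theorem svrgJ_ge : 100 * S.κ ≤ S.svrgJ := Nat.le_ceil _

/-- The inner loop of Prox-SVRG. -/
theorem svrgLoop_spec (R : S.Represents P Q) {xt : Vec d} (hxt : xt ∈ Q.D) (J : ℕ) :
    Always P (fun s => Q.IsWeightedSum J s.2)
        (loop (fun _ s => S.svrgStep xt (Q.gbar xt) s) (xt, 0) J) ∧
      6 / 5 * (1 / (10 * Q.ℓ)) * (loop (fun _ s => S.svrgStep xt (Q.gbar xt) s) (xt, 0) J).expect P
        (fun s => J * Q.gap ((J : ℝ)⁻¹ • s.2))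
      ≤ ‖xt - Q.xs‖ ^ 2 + 4 / 5 * (1 / (10 * Q.ℓ)) * (J + 1) * Q.gap xt := by
  have hQ := R.valid
  have hl := hQ.ℓ_pos
  set η := 1 / (10 * Q.ℓ) with hη
  have hη0 : 0 < η := by positivity
  have hηl : η * Q.ℓ = 1 / 10 := by rw [hη]; field_simp
  set I : ℕ → Vec d × Vec d → Prop := fun n s => s.1 ∈ Q.D ∧ Q.IsWeightedSum n s.2 with hI
  set u : Vec d → Fin m → Vec d := fun x i =>
    S.proxpV P (1 / (10 * S.ℓ)) (x - (1 / (10 * S.ℓ)) • (Q.gbar xt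
      + (S.gradV P i x - S.gradV P i xt))) with hu
  have hstep : ∀ x i, Q.IsProxStep η x (Q.est xt x i) (u x i) := by
    intro x i
    have := R.prox η hη0 x (Q.est xt x i)
    simp only [hu, R.gf, R.ℓ_eq]
    exact this
  have hs : ∀ (n : ℕ) b, I n b → Always P (I (n + 1)) (S.svrgStep xt (Q.gbar xt) b) := by
    intro n b hb i
    change u b.1 i ∈ Q.D ∧ Q.IsWeightedSum ((n + 1 : ℕ) : ℝ) (b.2 + u b.1 i)
    have := (hb.2.add hQ one_pos (hstep b.1 i).1).1
    rw [one_smul] at this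
    push_cast
    exact ⟨(hstep b.1 i).1, this⟩
  have h0 : I 0 (xt, 0) := ⟨hxt, Or.inl ⟨by simp, rfl⟩⟩
  refine ⟨(always_loop I h0 hs J).mono fun s h => h.2, ?_⟩
  -- For η = 1/(10ℓ) the variance factor 8ℓη² is 4η/5. Of the 2η · gap gained at a new point, 4η/5
  -- is kept to pay for the next step's variance and 6η/5 goes to the running mean.
  set V : ℕ → Vec d × Vec d → ℝ := fun n s => ‖s.1 - Q.xs‖ ^ 2 + 4 / 5 * η * Q.gap s.1
    + 6 / 5 * η * (n * Q.gap ((n : ℝ)⁻¹ • s.2)) with hV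
  have key := expect_loop_le_add (P := P) hQ.m_pos I h0 hs V (c := 4 / 5 * η * Q.gap xt) (by
    intro n b hb
    change avg (fun i => V (n + 1) (u b.1 i, b.2 + u b.1 i)) ≤ _
    have h1 : ∀ i, V (n + 1) (u b.1 i, b.2 + u b.1 i) ≤
        2 * η * Q.gap (u b.1 i) + ‖u b.1 i - Q.xs‖ ^ 2
          + 6 / 5 * η * (n * Q.gap ((n : ℝ)⁻¹ • b.2)) := by
      intro i
      have := (hb.2.add hQ one_pos (hstep b.1 i).1).2
      rw [one_smul, one_mul] at this
      simp only [hV, Nat.cast_add, Nat.cast_one]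
      have := mul_le_mul_of_nonneg_left this (show 0 ≤ 6 / 5 * η by positivity)
      linarith
    refine (avg_mono h1).trans ?_
    rw [avg_add, avg_const hQ.m_pos]
    have h3 := hQ.svrg_step hη0 (by rw [hηl]; norm_num) hxt hb.1 (hstep b.1)
    have h4 : 8 * Q.ℓ * η ^ 2 = 4 / 5 * η := by
      rw [show 8 * Q.ℓ * η ^ 2 = 8 * η * (η * Q.ℓ) by ring, hηl]; ring
    rw [h4] at h3
    simp only [hV]
    linarith) J
  have h5 : (loop (fun _ s => S.svrgStep xt (Q.gbar xt) s) (xt, 0) J).expect P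
      (fun s => 6 / 5 * η * (J * Q.gap ((J : ℝ)⁻¹ • s.2))) ≤
      (loop (fun _ s => S.svrgStep xt (Q.gbar xt) s) (xt, 0) J).expect P (V J) := by
    refine expect_mono ((always_loop I h0 hs J).mono fun s h => ?_)
    have := hQ.gap_nonneg h.1
    simp only [hV]
    have : 0 ≤ ‖s.1 - Q.xs‖ ^ 2 + 4 / 5 * η * Q.gap s.1 := by positivity
    linarith
  rw [expect_const_mul] at h5
  refine (h5.trans key).trans (le_of_eq ?_)
  simp only [hV, Nat.cast_zero, zero_mul, mul_zero, add_zero]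
  ring

theorem svrgJ_pos (R : S.Represents P Q) : (0 : ℝ) < S.svrgJ := by
  have h1 := R.one_le_κ
  have h2 := svrgJ_ge (S := S)
  linarith

theorem always_svrgEpoch (R : S.Represents P Q) {xt : Vec d} (hxt : xt ∈ Q.D) :
    Always P (fun u => u ∈ Q.D) (S.svrgEpoch xt) := by
  rw [svrgEpoch_eq]
  refine (always_gradAll xt).bind fun G hG => ?_
  subst hG
  rw [sum_gradV R]
  refine (svrgLoop_spec R hxt S.svrgJ).1.bind fun s hs => ?_
  have hJ := svrgJ_pos R
  rcases hs with ⟨h, -⟩ | ⟨-, h⟩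
  · exact absurd h hJ.ne'
  · rw [one_div]
    exact h

theorem expect_svrgEpoch (R : S.Represents P Q) {xt : Vec d} (hxt : xt ∈ Q.D) :
    (S.svrgEpoch xt).expect P Q.gap ≤ 9 / 10 * Q.gap xt := by
  have hQ := R.valid
  have hl := hQ.ℓ_pos
  have hμ := hQ.μ_pos
  rw [svrgEpoch_eq, expect_bind_of_always_eq hQ.m_pos (always_gradAll xt), sum_gradV R, expect_bind]
  have h := (svrgLoop_spec R hxt S.svrgJ).2
  rw [expect_const_mul] at h
  have hJ := svrgJ_pos R
  have hJκ := svrgJ_ge (S := S)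
  have hκ := R.one_le_κ
  have hκμ := κ_mul_μ R
  simp only [one_div (S.svrgJ : ℝ)]
  change (loop (fun _ s => S.svrgStep xt (Q.gbar xt) s) (xt, 0) S.svrgJ).expect P
    (fun s => Q.gap ((S.svrgJ : ℝ)⁻¹ • s.2)) ≤ _
  set e := (loop (fun _ s => S.svrgStep xt (Q.gbar xt) s) (xt, 0) S.svrgJ).expect P
    (fun s => Q.gap ((S.svrgJ : ℝ)⁻¹ • s.2))
  set J : ℝ := (S.svrgJ : ℝ)
  have hg := hQ.gap_nonneg hxt
  have hgr := hQ.growth hxt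
  have h1 : ‖xt - Q.xs‖ ^ 2 ≤ 2 / Q.μ * Q.gap xt := by
    rw [div_mul_eq_mul_div, le_div_iff₀ hμ]
    linarith
  have h2 : 6 / 5 * (1 / (10 * Q.ℓ)) * (J * e) * (10 * Q.ℓ) = 6 / 5 * (J * e) := by field_simp
  have h3 : (2 / Q.μ * Q.gap xt + 4 / 5 * (1 / (10 * Q.ℓ)) * (J + 1) * Q.gap xt) * (10 * Q.ℓ) =
      (20 * S.κ + 4 / 5 * (J + 1)) * Q.gap xt := by
    rw [← hκμ] at hl ⊢
    have : S.κ ≠ 0 := by linarith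
    field_simp
    ring
  have h4 : 6 / 5 * (1 / (10 * Q.ℓ)) * (J * e) * (10 * Q.ℓ) ≤
      (2 / Q.μ * Q.gap xt + 4 / 5 * (1 / (10 * Q.ℓ)) * (J + 1) * Q.gap xt) * (10 * Q.ℓ) := by
    gcongr
    linarith
  rw [h2, h3] at h4
  -- From J ≥ 100κ: 20κ ≤ J/5, and J/5 + 4(J + 1)/5 ≤ 27J/25.
  have h5 : (20 * S.κ + 4 / 5 * (J + 1)) * Q.gap xt ≤ (6 / 5 * J * (9 / 10)) * Q.gap xt := by
    gcongr
    linarith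
  have h6 : (6 / 5 * J) * e ≤ (6 / 5 * J) * (9 / 10 * Q.gap xt) := by linarith
  exact le_of_mul_le_mul_left h6 (by positivity)

end Represents

/-! #### Katyusha -/

variable (S) in
/-- The inner step of Katyusha. -/
def katStep (xt vt : Vec d) (G : Fin m → Vec d) (j : ℕ) (s : Vec d × Vec d × Vec d) :
    Prog d m (Vec d × Vec d × Vec d) :=
  pick fun i => do
    let x : Vec d :=
      S.katτ₁ • s.2.1 + (1 / 2 : ℝ) • xt + (1 - S.katτ₁ - 1 / 2) • s.1
    let a ← S.gradf i x
    let v : Vec d := vt + (a - G i)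
    let z ← S.proxp S.katα (s.2.1 - S.katα • v)
    let y ← S.proxp (1 / (3 * S.ℓ)) (x - (1 / (3 * S.ℓ)) • v)
    pure (y, z, s.2.2 + S.katθ ^ j • y)

variable (S) in
/-- The total weight of the first `n` inner steps of Katyusha. -/
def katW (n : ℕ) : ℝ := ∑ j ∈ Finset.range n, S.katθ ^ j

theorem katEpoch_eq (st : Vec d × Vec d × Vec d) :
    S.katEpoch st = (S.gradAll st.1 >>= fun G =>
      loop (S.katStep st.1 ((1 / m : ℝ) • ∑ i, G i) G) (st.2.1, st.2.2, 0) (2 * m) >>= fun r =>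
      pure ((S.katW (2 * m))⁻¹ • r.2.2, r.1, r.2.1)) := rfl

theorem cost_katEpoch_le (st : Vec d × Vec d × Vec d) :
    (S.katEpoch st).cost P ≤ m * 2 + 2 * m * 4 := by
  rw [katEpoch_eq]
  refine cost_bind_le (cost_gradAll_le _) (always_of_forall (fun G => ?_) _)
  refine cost_bind_le (b := 2 * m * 4) (c := 0) ?_ (always_of_forall (fun _ => le_rfl) _)
  refine cost_loop_le (fun _ _ => True) trivial
    (fun _ _ _ => always_of_forall (fun _ => trivial) _) (fun _ _ _ => ?_) _
  -- One component gradient (the snapshot's is stored), costing two operations, and two proxes of g.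
  exact Finset.sup_le fun _ _ => le_rfl

namespace Represents

theorem katτ_pos (R : S.Represents P Q) : 0 < S.katτ₁ := by
  have h1 := R.one_le_κ
  have h2 : (0 : ℝ) < m := Nat.cast_pos.2 R.valid.m_pos
  exact lt_min (Real.sqrt_pos.2 (by positivity)) (by norm_num)

theorem katα_eq (R : S.Represents P Q) : S.katα = 1 / (3 * S.katτ₁ * Q.ℓ) := by rw [katα, R.ℓ_eq]

theorem katα_pos (R : S.Represents P Q) : 0 < S.katα := by
  have := R.valid.ℓ_pos
  have := katτ_pos R
  rw [katα_eq R]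
  positivity

theorem katθ_eq (R : S.Represents P Q) : S.katθ = 1 + S.katα * Q.μ := by rw [katθ, R.μ_eq]; ring

theorem one_le_katθ (R : S.Represents P Q) : 1 ≤ S.katθ := by
  have := R.valid.μ_pos
  have := katα_pos R
  rw [katθ_eq R]
  nlinarith [mul_pos (katα_pos R) R.valid.μ_pos]

/-- The number of inner steps times the increment of the weight base is at least `τ₁`. -/
theorem katτ_le (R : S.Represents P Q) : S.katτ₁ ≤ 2 * m * (S.katα * Q.μ) := by
  have h0 := katτ_pos R
  have h1 := R.one_le_κ
  have hμ := R.valid.μ_pos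
  have h2 : (0 : ℝ) < m := Nat.cast_pos.2 R.valid.m_pos
  have h3 : S.katτ₁ ^ 2 ≤ 2 * m / (3 * S.κ) := by
    rw [← Real.sq_sqrt (show (0 : ℝ) ≤ 2 * m / (3 * S.κ) by positivity)]
    exact pow_le_pow_left₀ h0.le (min_le_left _ _) 2
  have h4 : 2 * m * (S.katα * Q.μ) = 2 * m / (3 * S.κ) / S.katτ₁ := by
    rw [katα_eq R, ← κ_mul_μ R]
    have : S.κ ≠ 0 := by linarith
    field_simp
  rw [h4, le_div_iff₀ h0]
  linarith

/-- The left factor 1/2 is the snapshot's weight, so this is the gain 1 + τ on the averaged point.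
If τ < 1/2, then 2m · aμ = τ and so aμ ≤ τ/2, where a is the step size; if τ = 1/2, the right side
is 1. -/
theorem kat_coef (R : S.Represents P Q) : (1 + S.katτ₁) / 2 ≤ 1 - (1 / 2 - S.katτ₁) * S.katθ := by
  have h0 := katτ_pos R
  have h1 := R.one_le_κ
  have hμ := R.valid.μ_pos
  have h2 : (1 : ℝ) ≤ m := by exact_mod_cast R.valid.m_pos
  rcases le_total (√(2 * m / (3 * S.κ))) (1 / 2) with h | h
  · have hτ : S.katτ₁ = √(2 * m / (3 * S.κ)) := min_eq_left h
    have h3 : S.katτ₁ ^ 2 = 2 * m / (3 * S.κ) := by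
      rw [hτ, Real.sq_sqrt (by positivity)]
    have h4 : 2 * m * (S.katα * Q.μ) = S.katτ₁ := by
      have : 2 * m * (S.katα * Q.μ) = 2 * m / (3 * S.κ) / S.katτ₁ := by
        rw [katα_eq R, ← κ_mul_μ R]
        have : S.κ ≠ 0 := by linarith
        field_simp
      rw [this, ← h3]
      field_simp
    have h5 : 0 < S.katα * Q.μ := mul_pos (katα_pos R) hμ
    rw [katθ_eq R]
    have h6 : 2 * (S.katα * Q.μ) ≤ S.katτ₁ := by nlinarith
    nlinarith
  · have hτ : S.katτ₁ = 1 / 2 := min_eq_right h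
    rw [hτ]
    norm_num

theorem katτ_le_half : S.katτ₁ ≤ 1 / 2 := min_le_right _ _

theorem le_katW (R : S.Represents P Q) (n : ℕ) : (n : ℝ) ≤ S.katW n := by
  have h := one_le_katθ R
  have : ∑ j ∈ Finset.range n, (1 : ℝ) ≤ S.katW n :=
    Finset.sum_le_sum fun j _ => one_le_pow₀ h
  simpa using this

/-- Bernoulli's inequality with `katτ_le`: the weights over an epoch grow by at least the
contraction factor. -/
theorem kat_pow_ge (R : S.Represents P Q) : 1 + S.katτ₁ ≤ S.katθ ^ (2 * m) := by
  have h := one_add_mul_le_pow (a := S.katα * Q.μ)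
    (by linarith [mul_pos (katα_pos R) R.valid.μ_pos]) (2 * m)
  rw [← katθ_eq R] at h
  have h2 := katτ_le R
  push_cast at h
  linarith

variable (S Q) in
/-- The potential of Katyusha between two epochs. -/
def katPot (st : Vec d × Vec d × Vec d) : ℝ :=
  S.katα / S.katτ₁ * (1 / 2 * S.katW (2 * m) * Q.gap st.1 + (1 / 2 - S.katτ₁) * Q.gap st.2.1)
    + 1 / 2 * ‖st.2.2 - Q.xs‖ ^ 2

/-- The inner loop of Katyusha. -/
theorem katLoop_spec (R : S.Represents P Q) {xt y z : Vec d} (hxt : xt ∈ Q.D) (hy : y ∈ Q.D) (M : ℕ) :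
    Always P (fun s => s.1 ∈ Q.D ∧ Q.IsWeightedSum (S.katW M) s.2.2)
        (loop (S.katStep xt (Q.gbar xt) fun i => S.gradV P i xt) (y, z, 0) M) ∧
      (loop (S.katStep xt (Q.gbar xt) fun i => S.gradV P i xt) (y, z, 0) M).expect P
        (fun s => S.katα / S.katτ₁ * (1 - (1 / 2 - S.katτ₁) * S.katθ)
            * (S.katW M * Q.gap ((S.katW M)⁻¹ • s.2.2))
          + S.katθ ^ M * (S.katα / S.katτ₁ * ((1 / 2 - S.katτ₁) * Q.gap s.1)
            + 1 / 2 * ‖s.2.1 - Q.xs‖ ^ 2))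
      ≤ S.katα / S.katτ₁ * (1 / 2 * S.katW M * Q.gap xt + (1 / 2 - S.katτ₁) * Q.gap y)
          + 1 / 2 * ‖z - Q.xs‖ ^ 2 := by
  have hQ := R.valid
  have hl := hQ.ℓ_pos
  have hτ := katτ_pos R
  have hα := katα_pos R
  have hθ := one_le_katθ R
  have hθe := katθ_eq R
  have hcoef : 0 ≤ 1 - (1 / 2 - S.katτ₁) * S.katθ := by linarith [kat_coef R]
  have hτ2 := katτ_le_half (S := S)
  set τ := S.katτ₁ with hτdef
  set a := S.katα with hadef
  set θ := S.katθ with hθdef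
  set I : ℕ → Vec d × Vec d × Vec d → Prop :=
    fun n s => s.1 ∈ Q.D ∧ Q.IsWeightedSum (S.katW n) s.2.2 with hI
  set w : Vec d × Vec d × Vec d → Vec d := fun s =>
    τ • s.2.1 + (1 / 2 : ℝ) • xt + (1 - τ - 1 / 2) • s.1 with hw
  set v : Vec d × Vec d × Vec d → Fin m → Vec d := fun s i =>
    Q.gbar xt + (S.gradV P i (w s) - S.gradV P i xt) with hv
  set z' : Vec d × Vec d × Vec d → Fin m → Vec d := fun s i =>
    S.proxpV P a (s.2.1 - a • v s i) with hz'
  set y' : Vec d × Vec d × Vec d → Fin m → Vec d := fun s i =>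
    S.proxpV P (1 / (3 * S.ℓ)) (w s - (1 / (3 * S.ℓ)) • v s i) with hy'
  have hvest : ∀ s i, v s i = Q.est xt (w s) i := by
    intro s i
    simp only [hv, R.gf, Composite.est]
  have hzstep : ∀ s i, Q.IsProxStep a s.2.1 (Q.est xt (w s) i) (z' s i) := by
    intro s i
    have := R.prox a hα s.2.1 (v s i)
    rw [← hvest]
    exact this
  have hystep : ∀ s i, Q.IsProxStep (1 / (3 * Q.ℓ)) (w s) (Q.est xt (w s) i) (y' s i) := by
    intro s i
    have := R.prox (1 / (3 * Q.ℓ)) (by positivity) (w s) (v s i)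
    rw [← R.ℓ_eq] at this ⊢
    rw [← hvest]
    exact this
  have hW : ∀ n, S.katW (n + 1) = S.katW n + θ ^ n := fun n => Finset.sum_range_succ _ _
  have hs : ∀ (n : ℕ) b, I n b →
      Always P (I (n + 1)) (S.katStep xt (Q.gbar xt) (fun i => S.gradV P i xt) n b) := by
    intro n b hb i
    change y' b i ∈ Q.D ∧ Q.IsWeightedSum (S.katW (n + 1)) (b.2.2 + θ ^ n • y' b i)
    rw [hW]
    exact ⟨(hystep b i).1, (hb.2.add hQ (by positivity) (hystep b i).1).1⟩
  have h0 : I 0 (y, z, 0) := ⟨hy, Or.inl ⟨by simp [katW], rfl⟩⟩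
  refine ⟨always_loop I h0 hs M, ?_⟩
  -- Of the weight θⁿ on the gap of the new y, the share (1/2 - τ)θ pays for the next step and the
  -- rest goes to the running mean. The distance terms telescope since θ = 1 + aμ, and the last
  -- summand subtracts the snapshot's contributions, so V does not grow in expectation.
  set V : ℕ → Vec d × Vec d × Vec d → ℝ := fun n s =>
    (a / τ * (1 - (1 / 2 - τ) * θ) * (S.katW n * Q.gap ((S.katW n)⁻¹ • s.2.2))
      + θ ^ n * (a / τ * ((1 / 2 - τ) * Q.gap s.1) + 1 / 2 * ‖s.2.1 - Q.xs‖ ^ 2))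
      + -(S.katW n * (a / τ * (1 / 2 * Q.gap xt))) with hV
  have key := expect_loop_le_add (P := P) hQ.m_pos I h0 hs V (c := 0) (by
    intro n b hb
    change avg (fun i => V (n + 1) (y' b i, z' b i, b.2.2 + θ ^ n • y' b i)) ≤ _
    have hθn : 0 < θ ^ n := by positivity
    have h1 : ∀ i, V (n + 1) (y' b i, z' b i, b.2.2 + θ ^ n • y' b i) ≤
        θ ^ n * (a / τ * Q.gap (y' b i) + (1 + a * Q.μ) / 2 * ‖z' b i - Q.xs‖ ^ 2)
          + (a / τ * (1 - (1 / 2 - τ) * θ) * (S.katW n * Q.gap ((S.katW n)⁻¹ • b.2.2))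
            - (S.katW n + θ ^ n) * (a / τ * (1 / 2 * Q.gap xt))) := by
      intro i
      have := (hb.2.add hQ hθn (hystep b i).1).2
      have := mul_le_mul_of_nonneg_left this
        (show 0 ≤ a / τ * (1 - (1 / 2 - τ) * θ) by positivity)
      simp only [hV, hW, pow_succ]
      rw [← hθe]
      linarith
    refine (avg_mono h1).trans ?_
    rw [avg_add, avg_const_mul, avg_const hQ.m_pos]
    have h3 := hQ.katyusha_step hτ hτ2 (katα_eq R) hxt hb.1 (x := w b) (z := b.2.1) rfl
      (hzstep b) (hystep b)
    have h4 := mul_le_mul_of_nonneg_left h3 hθn.le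
    simp only [hV]
    linarith) M
  have hW0 : S.katW 0 = 0 := by simp [katW]
  simp only [hV] at key
  rw [expect_add, expect_const hQ.m_pos, hW0] at key
  simp only [zero_mul, mul_zero, pow_zero, one_mul, zero_add, neg_zero, add_zero] at key
  linarith

/-- Each part of the potential gains the factor 1 + τ: the new snapshot by `kat_coef`, the last y
and z by `kat_pow_ge`. -/
theorem katEpoch_spec (R : S.Represents P Q) {st : Vec d × Vec d × Vec d} (hst : st.1 ∈ Q.D ∧ st.2.1 ∈ Q.D) :
    Always P (fun s => s.1 ∈ Q.D ∧ s.2.1 ∈ Q.D) (S.katEpoch st) ∧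
      (S.katEpoch st).expect P (katPot S Q) ≤ (1 + S.katτ₁)⁻¹ * katPot S Q st := by
  have hQ := R.valid
  have hτ := katτ_pos R
  have hα := katα_pos R
  have hm : (0 : ℝ) < m := Nat.cast_pos.2 hQ.m_pos
  have hWpos : 0 < S.katW (2 * m) := by
    have := le_katW R (2 * m)
    push_cast at this
    linarith
  obtain ⟨h1, h2⟩ := katLoop_spec R (z := st.2.2) hst.1 hst.2 (2 * m)
  have hmem : ∀ s : Vec d × Vec d × Vec d, s.1 ∈ Q.D ∧ Q.IsWeightedSum (S.katW (2 * m)) s.2.2 →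
      (S.katW (2 * m))⁻¹ • s.2.2 ∈ Q.D := by
    rintro s ⟨-, ⟨h, -⟩ | ⟨-, h⟩⟩
    · exact absurd h hWpos.ne'
    · exact h
  rw [katEpoch_eq]
  constructor
  · refine (always_gradAll _).bind fun G hG => ?_
    subst hG
    rw [sum_gradV R]
    exact h1.bind fun s hs => ⟨hmem s hs, hs.1⟩
  · rw [expect_bind_of_always_eq hQ.m_pos (always_gradAll _), sum_gradV R, expect_bind,
      inv_mul_eq_div, le_div_iff₀ (by positivity), mul_comm, ← expect_const_mul]
    refine le_trans (expect_mono (h1.mono fun s hs => ?_)) h2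
    change (1 + S.katτ₁) * (S.katα / S.katτ₁ * (1 / 2 * S.katW (2 * m)
      * Q.gap ((S.katW (2 * m))⁻¹ • s.2.2) + (1 / 2 - S.katτ₁) * Q.gap s.1)
      + 1 / 2 * ‖s.2.1 - Q.xs‖ ^ 2) ≤ _
    have g1 := hQ.gap_nonneg (hmem s hs)
    have g2 := hQ.gap_nonneg hs.1
    have hτ2 := katτ_le_half (S := S)
    have e1 : (1 + S.katτ₁) / 2 * (S.katα / S.katτ₁ * (S.katW (2 * m)
        * Q.gap ((S.katW (2 * m))⁻¹ • s.2.2))) ≤ (1 - (1 / 2 - S.katτ₁) * S.katθ) *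
        (S.katα / S.katτ₁ * (S.katW (2 * m) * Q.gap ((S.katW (2 * m))⁻¹ • s.2.2))) :=
      mul_le_mul_of_nonneg_right (kat_coef R) (by positivity)
    have g3 : 0 ≤ S.katα / S.katτ₁ * ((1 / 2 - S.katτ₁) * Q.gap s.1)
        + 1 / 2 * ‖s.2.1 - Q.xs‖ ^ 2 := by
      have : 0 ≤ 1 / 2 - S.katτ₁ := by linarith
      positivity
    have e2 := mul_le_mul_of_nonneg_right (kat_pow_ge R) g3
    linarith

/-- Katyusha started at a point `u`. -/
theorem katyusha_spec (R : S.Represents P Q) {u : Vec d} (hu : u ∈ Q.D) (T : ℕ) :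
    Always P (fun s => s.1 ∈ Q.D) (loop (fun _ st => S.katEpoch st) (u, u, u) T) ∧
      (loop (fun _ st => S.katEpoch st) (u, u, u) T).expect P (fun s => Q.gap s.1)
        ≤ 4 * ((1 + S.katτ₁)⁻¹ ^ T * Q.gap u) := by
  have hQ := R.valid
  have hμ := hQ.μ_pos
  have hτ := katτ_pos R
  have hα := katα_pos R
  have hτ2 := katτ_le_half (S := S)
  have hm : (1 : ℝ) ≤ m := by exact_mod_cast hQ.m_pos
  have hW := le_katW R (2 * m)
  push_cast at hW
  have hal := always_loop (P := P) (a := (u, u, u)) (f := fun _ st => S.katEpoch st)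
    (fun _ s => s.1 ∈ Q.D ∧ s.2.1 ∈ Q.D) ⟨hu, hu⟩ (fun n b hb => (katEpoch_spec R hb).1) T
  refine ⟨hal.mono fun s hs => hs.1, ?_⟩
  have key := expect_loop_le_pow (P := P) (a := (u, u, u)) (f := fun _ st => S.katEpoch st)
    (fun s => s.1 ∈ Q.D ∧ s.2.1 ∈ Q.D) ⟨hu, hu⟩ (fun n b hb => (katEpoch_spec R hb).1)
    (katPot S Q) (inv_nonneg.2 (by linarith)) (fun n b hb => (katEpoch_spec R hb).2) T
  set ρ := (1 + S.katτ₁)⁻¹ ^ T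
  have hρ : 0 ≤ ρ := by positivity
  set A := S.katα / S.katτ₁ * (1 / 2 * S.katW (2 * m)) with hA
  have hWpos : 0 < S.katW (2 * m) := by linarith
  have hA0 : 0 < A := by positivity
  have hgu := hQ.gap_nonneg hu
  have h1 : A * (loop (fun _ st => S.katEpoch st) (u, u, u) T).expect P (fun s => Q.gap s.1) ≤
      (loop (fun _ st => S.katEpoch st) (u, u, u) T).expect P (katPot S Q) := by
    rw [← expect_const_mul]
    refine expect_mono (hal.mono fun s hs => ?_)
    have g2 := hQ.gap_nonneg hs.2
    have g3 : 0 ≤ S.katα / S.katτ₁ * ((1 / 2 - S.katτ₁) * Q.gap s.2.1)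
        + 1 / 2 * ‖s.2.2 - Q.xs‖ ^ 2 := by
      have : 0 ≤ 1 / 2 - S.katτ₁ := by linarith
      positivity
    simp only [katPot, hA]
    linarith
  -- The snapshot term and the y term contribute at most one `A * gap` each. The distance
  -- contributes at most two, by quadratic growth and A μ ≥ 1/2.
  have h2 : katPot S Q (u, u, u) ≤ 4 * (A * Q.gap u) := by
    have e1 : 1 / 2 * ‖u - Q.xs‖ ^ 2 ≤ 2 * (A * Q.gap u) := by
      have f1 := hQ.growth hu
      have f2 := katτ_le R
      have f3 : 1 / 2 ≤ A * Q.μ := by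
        have : S.katτ₁ ≤ S.katW (2 * m) * (S.katα * Q.μ) :=
          f2.trans (mul_le_mul_of_nonneg_right hW (by positivity))
        rw [hA]
        rw [show S.katα / S.katτ₁ * (1 / 2 * S.katW (2 * m)) * Q.μ =
          1 / 2 * (S.katW (2 * m) * (S.katα * Q.μ)) / S.katτ₁ by ring, le_div_iff₀ hτ]
        linarith
      have f4 : 1 / 2 * ‖u - Q.xs‖ ^ 2 ≤ A * Q.μ * ‖u - Q.xs‖ ^ 2 := by gcongr
      have f5 := mul_le_mul_of_nonneg_left f1 hA0.le
      linarith
    have e2 : S.katα / S.katτ₁ * ((1 / 2 - S.katτ₁) * Q.gap u) ≤ A * Q.gap u := by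
      rw [hA, mul_assoc]
      gcongr
      nlinarith
    simp only [katPot]
    simp only [hA] at e1 e2 ⊢
    linarith
  have h3 := mul_le_mul_of_nonneg_left h2 hρ
  have h4 : A * (loop (fun _ st => S.katEpoch st) (u, u, u) T).expect P (fun s => Q.gap s.1) ≤
      A * (4 * (ρ * Q.gap u)) := by linarith
  exact le_of_mul_le_mul_left h4 hA0

end Represents

end Subproblem

/-! ### Solving a subproblem -/

namespace Subproblem

variable {d m : ℕ} {S : Subproblem d m} {P : Problem d m} {Q : Composite d m}

/-- By (1 - τ)^T ≤ exp(-Tτ), the iteration count reaches the factor 1/(4t) = μ/4 that the outer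
descent can afford. -/
theorem pow_innerIter_mul_le {γ τ : ℝ} (ht : 0 < S.t) (hγ : 0 < γ) (hτ : 0 < τ) (hτ1 : τ ≤ 1) :
    (1 - τ) ^ S.innerIter γ τ * γ ≤ 1 / (4 * S.t) := by
  set T := S.innerIter γ τ with hT
  have h1 : 1 / τ * Real.log (4 * S.t * γ) ≤ T := Nat.le_ceil _
  have h2 : Real.log (4 * S.t * γ) ≤ T * τ := by
    rwa [one_div, inv_mul_eq_div, div_le_iff₀ hτ] at h1
  have h3 : (1 - τ) ^ T ≤ Real.exp (-(T * τ)) := by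
    have := pow_le_pow_left₀ (by linarith) (Real.one_sub_le_exp_neg τ) T
    rwa [← Real.exp_nat_mul, mul_neg] at this
  have h4 : Real.exp (-(T * τ)) ≤ (4 * S.t * γ)⁻¹ := by
    rw [Real.exp_neg]
    refine inv_anti₀ (by positivity) ?_
    rw [← Real.log_le_iff_le_exp (by positivity)]
    exact h2
  calc (1 - τ) ^ T * γ ≤ (4 * S.t * γ)⁻¹ * γ := by gcongr; exact h3.trans h4
    _ = 1 / (4 * S.t) := by field_simp

theorem kat_rate_eq :
    max (1 + √(2 * m / (3 * S.κ)))⁻¹ (3 / 2 : ℝ)⁻¹ = (1 + S.katτ₁)⁻¹ := by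
  rw [katτ₁]
  rcases le_total (√(2 * m / (3 * S.κ))) (1 / 2) with h | h
  · rw [min_eq_left h, max_eq_left]
    exact inv_anti₀ (by positivity) (by linarith)
  · rw [min_eq_right h, max_eq_right, show (3 / 2 : ℝ) = 1 + 1 / 2 by norm_num]
    exact inv_anti₀ (by norm_num) (by linarith)

/-- The number of individual gradient evaluations of the better of the two methods. -/
def work (S : Subproblem d m) : ℕ :=
  min (S.svrgT * (m + 2 * S.svrgJ)) (S.katT * (3 * m))

/-- The factor 4 covers both methods: 2m + 5J ≤ 4(m + 2J) per Prox-SVRG epoch and 10m ≤ 4 · 3m per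
Katyusha epoch. -/
theorem cost_solve_le (x : Vec d) : (S.solve x).cost P ≤ m * 2 + 1 + 4 * S.work := by
  rw [solve, work]
  split_ifs with h
  · rw [min_eq_left h]
    refine cost_bind_le (cost_proxGradStep_le x) (always_of_forall (fun z => ?_) _)
    refine (cost_loop_le (fun _ _ => True) trivial
      (fun _ _ _ => always_of_forall (fun _ => trivial) _)
      (fun _ b _ => cost_svrgEpoch_le b) _).trans ?_
    nlinarith [Nat.zero_le (S.svrgT * m), Nat.zero_le (S.svrgT * S.svrgJ)]
  · rw [min_eq_right (not_le.1 h).le]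
    refine cost_bind_le (cost_proxGradStep_le x) (always_of_forall (fun z => ?_) _)
    refine (cost_bind_le (c := 0) (cost_loop_le (fun _ _ => True) trivial
      (fun _ _ _ => always_of_forall (fun _ => trivial) _)
      (fun _ b _ => cost_katEpoch_le b) _) (always_of_forall (fun _ => le_rfl) _)).trans ?_
    nlinarith [Nat.zero_le (S.katT * m)]

namespace Represents

/-- The initial prox-gradient step trades the gap for ℓ/2 ‖x - z*‖², z* being the minimizer; the
epochs shrink this to the required fraction. Katyusha's extra factor 4 is why its γ is 4ℓ/2. -/
theorem solve_spec (R : S.Represents P Q) (x : Vec d) :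
    Always P (fun u => u ∈ Q.D) (S.solve x) ∧
      (S.solve x).expect P Q.gap ≤ 1 / (4 * S.t) * ‖x - Q.xs‖ ^ 2 := by
  have hQ := R.valid
  have hl := hQ.ℓ_pos
  have ht := R.t_pos
  have hκ := R.one_le_κ
  have hst := proxGradStep_spec R x
  rw [solve]
  split_ifs with h
  · refine ⟨hst.bind fun u hu => ?_, ?_⟩
    · exact always_loop (fun _ u => u ∈ Q.D) hu.1 (fun _ b hb => always_svrgEpoch R hb) _
    · rw [svrgPlus, expect_bind, ← expect_const (P := P) hQ.m_pos
        (1 / (4 * S.t) * ‖x - Q.xs‖ ^ 2) (S.proxGradStep x)]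
      refine expect_mono (hst.mono fun u hu => ?_)
      have h1 := expect_loop_le_pow (P := P) (f := fun _ xt => S.svrgEpoch xt) (a := u)
        (fun u => u ∈ Q.D) hu.1 (fun _ b hb => always_svrgEpoch R hb) Q.gap (ρ := 9 / 10)
        (by norm_num) (fun _ b hb => expect_svrgEpoch R hb) S.svrgT
      have h2 := pow_innerIter_mul_le (S := S) (γ := S.ℓ / 2) (τ := 1 / 10) ht
        (by rw [R.ℓ_eq]; positivity) (by norm_num) (by norm_num)
      rw [show (1 - 1 / 10 : ℝ) = 9 / 10 by norm_num] at h2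
      change (9 / 10) ^ S.svrgT * _ ≤ _ at h2
      calc _ ≤ (9 / 10) ^ S.svrgT * Q.gap u := h1
        _ ≤ (9 / 10) ^ S.svrgT * (Q.ℓ / 2 * ‖x - Q.xs‖ ^ 2) := by gcongr; exact hu.2
        _ = (9 / 10) ^ S.svrgT * (S.ℓ / 2) * ‖x - Q.xs‖ ^ 2 := by rw [R.ℓ_eq]; ring
        _ ≤ _ := by gcongr
  · refine ⟨hst.bind fun u hu => ?_, ?_⟩
    · exact (katyusha_spec R hu.1 _).1.bind fun s hs => hs
    · rw [katPlus, expect_bind, ← expect_const (P := P) hQ.m_pos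
        (1 / (4 * S.t) * ‖x - Q.xs‖ ^ 2) (S.proxGradStep x)]
      refine expect_mono (hst.mono fun u hu => ?_)
      rw [expect_bind]
      have h1 := (katyusha_spec R hu.1 S.katT).2
      have hτ := katτ_pos R
      have hρ : (1 + S.katτ₁)⁻¹ < 1 := inv_lt_one_of_one_lt₀ (by linarith)
      have hρ0 : 0 < (1 + S.katτ₁)⁻¹ := by positivity
      have h2 := pow_innerIter_mul_le (S := S) (γ := 4 * S.ℓ / 2) (τ := 1 - (1 + S.katτ₁)⁻¹) ht
        (by rw [R.ℓ_eq]; positivity) (by linarith) (by linarith)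
      rw [sub_sub_cancel, ← kat_rate_eq] at h2
      change _ ^ S.katT * _ ≤ _ at h2
      rw [kat_rate_eq] at h2
      calc _ ≤ 4 * ((1 + S.katτ₁)⁻¹ ^ S.katT * Q.gap u) := h1
        _ ≤ 4 * ((1 + S.katτ₁)⁻¹ ^ S.katT * (Q.ℓ / 2 * ‖x - Q.xs‖ ^ 2)) := by
          gcongr; exact hu.2
        _ = (1 + S.katτ₁)⁻¹ ^ S.katT * (4 * S.ℓ / 2) * ‖x - Q.xs‖ ^ 2 := by rw [R.ℓ_eq]; ring
        _ ≤ _ := by gcongr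

end Represents

end Subproblem

/-! ### The smoothed subproblem as a composite problem -/

namespace Problem

variable {d m : ℕ} (P : Problem d m)

/-- The linearization of `cᵢ` at `x`. -/
def lin (i : Fin m) (x z : Vec d) : ℝ := P.c i x + ⟪∇ (P.c i) x, z - x⟫_ℝ

/-- The smoothed prox-linear model `F^ν_{1/μ}(·; x)` with smoothing parameter `ν = m r`. -/
def smoothModel (μ r : ℝ) (x z : Vec d) : EReal :=
  P.g z + ((avg (fun i => P.env i r (P.lin i x z)) + μ / 2 * ‖z - x‖ ^ 2 : ℝ) : EReal)

/-- The smoothed subproblem at `x`. -/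
def composite (μ r ℓ : ℝ) (x : Vec d) : Composite d m where
  f i z := P.env i r (P.lin i x z)
  gf i z := P.denv i r (P.lin i x z) • ∇ (P.c i) x
  p z := P.gR z + μ / 2 * ‖z - x‖ ^ 2
  D := P.dom
  ℓ := ℓ
  μ := μ
  xs := argmin (P.smoothModel μ r x)

variable {P} {L β B : ℝ}

theorem lin_sub (i : Fin m) (x z w : Vec d) :
    P.lin i x z - P.lin i x w = ⟪∇ (P.c i) x, z - w⟫_ℝ := by
  rw [lin, lin, add_sub_add_left_eq_sub, ← inner_sub_right, sub_sub_sub_cancel_right]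

theorem lin_self (i : Fin m) (x : Vec d) : P.lin i x x = P.c i x := by simp [lin]

theorem continuous_lin (i : Fin m) (x : Vec d) : Continuous (P.lin i x) := by
  unfold lin; fun_prop

theorem lin_combo (i : Fin m) (x : Vec d) {z w : Vec d} {a b : ℝ} (hab : a + b = 1) :
    P.lin i x (a • z + b • w) = a * P.lin i x z + b * P.lin i x w := by
  have h : a • z + b • w - x = a • (z - x) + b • (w - x) := by
    rw [smul_sub, smul_sub, sub_add_sub_comm, ← add_smul, hab, one_smul]
  rw [lin, lin, lin, h, inner_add_right, inner_smul_right, inner_smul_right]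
  linear_combination (-P.c i x) * hab

theorem Assumptions.continuous_env (h : P.Assumptions L β B) (i : Fin m) {r : ℝ} (hr : 0 < r) :
    Continuous (P.env i r) := by
  have : LipschitzWith (Real.toNNReal L) (P.env i r) := by
    refine LipschitzWith.of_dist_le_mul fun s t => ?_
    rw [Real.dist_eq, Real.dist_eq]
    refine le_trans ?_ (mul_le_mul_of_nonneg_right (Real.le_coe_toNNReal L) (abs_nonneg _))
    have h1 := h.env_lip i hr s t
    have h2 := h.env_lip i hr t s
    rw [abs_sub_comm t s] at h2
    exact abs_le.2 ⟨by linarith, h1⟩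
  exact this.continuous

/-- Composing the 1/r-smooth envelope with an affine map of slope ∇cᵢ(x) gives smoothness
‖∇cᵢ(x)‖²/r, at most ℓ by `hx`. -/
theorem Assumptions.smooth_composite (h : P.Assumptions L β B) (hm : 0 < m) {μ r ℓ : ℝ}
    (hr : 0 < r) (hℓ : 0 < ℓ) {x : Vec d} (hx : ∀ i, ‖∇ (P.c i) x‖ ^ 2 ≤ r * ℓ) :
    (P.composite μ r ℓ x).Smooth where
  m_pos := hm
  ℓ_pos := hℓ
  lower i w z := by
    have h1 := h.env_lower i hr (P.lin i x w) (P.lin i x z)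
    rw [lin_sub] at h1
    change P.env i r (P.lin i x w) + ⟪P.denv i r (P.lin i x w) • ∇ (P.c i) x, z - w⟫_ℝ
      + 1 / (2 * ℓ) * ‖P.denv i r (P.lin i x z) • ∇ (P.c i) x
        - P.denv i r (P.lin i x w) • ∇ (P.c i) x‖ ^ 2 ≤ P.env i r (P.lin i x z)
    rw [inner_smul_left, ← sub_smul, norm_smul, mul_pow, Real.norm_eq_abs, sq_abs]
    simp only [conj_trivial]
    set q := (P.denv i r (P.lin i x z) - P.denv i r (P.lin i x w)) ^ 2
    have h2 : 1 / (2 * ℓ) * (q * ‖∇ (P.c i) x‖ ^ 2) ≤ r / 2 * q := by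
      calc _ ≤ 1 / (2 * ℓ) * (q * (r * ℓ)) := by gcongr; exact hx i
        _ = r / 2 * q := by field_simp
    linarith

theorem Assumptions.smoothModel_growth (h : P.Assumptions L β B) (hm : 0 < m) {μ r ℓ : ℝ}
    (hμ : 0 < μ) (hr : 0 < r) (hℓ : 0 < ℓ) {x : Vec d} (hx : ∀ i, ‖∇ (P.c i) x‖ ^ 2 ≤ r * ℓ) :
    (P.composite μ r ℓ x).xs ∈ P.dom ∧ ∀ y ∈ P.dom,
      P.gR (P.composite μ r ℓ x).xs + (P.composite μ r ℓ x).fbar (P.composite μ r ℓ x).xs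
          + μ / 2 * ‖(P.composite μ r ℓ x).xs - x‖ ^ 2 + μ / 2 * ‖y - (P.composite μ r ℓ x).xs‖ ^ 2
        ≤ P.gR y + (P.composite μ r ℓ x).fbar y + μ / 2 * ‖y - x‖ ^ 2 := by
  have hs := h.smooth_composite hm hr hℓ hx (μ := μ)
  refine h.argmin_growth (f := P.smoothModel μ r x) ?_ hs.fbar_convex (by positivity) x fun z => rfl
  change Continuous fun z => avg fun i => P.env i r (P.lin i x z)
  unfold avg
  have h1 := fun i => h.continuous_env i hr
  have h2 := fun i => P.continuous_lin i x
  fun_prop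

theorem Assumptions.valid_composite (h : P.Assumptions L β B) (hm : 0 < m) {μ r ℓ : ℝ}
    (hμ : 0 < μ) (hr : 0 < r) (hℓ : 0 < ℓ) {x : Vec d} (hx : ∀ i, ‖∇ (P.c i) x‖ ^ 2 ≤ r * ℓ) :
    (P.composite μ r ℓ x).Valid := by
  have hs := h.smooth_composite hm hr hℓ hx (μ := μ)
  obtain ⟨hmem, hgr⟩ := h.smoothModel_growth hm hμ hr hℓ hx
  have hsc : ∀ z ∈ P.dom, ∀ y ∈ P.dom, ∀ a b : ℝ, 0 ≤ a → 0 ≤ b → a + b = 1 →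
      P.gR (a • z + b • y) + μ / 2 * ‖a • z + b • y - x‖ ^ 2 ≤
        a * (P.gR z + μ / 2 * ‖z - x‖ ^ 2) + b * (P.gR y + μ / 2 * ‖y - x‖ ^ 2)
          - a * b * (μ / 2 * ‖y - z‖ ^ 2) := by
    intro z hz y hy a b ha hb hab
    have h1 := h.convexOn_gR.2 hz hy ha hb hab
    have e1 : a • z + b • y - x = a • (z - x) + b • (y - x) := by
      rw [smul_sub, smul_sub, sub_add_sub_comm, ← add_smul, hab, one_smul]
    have e2 : y - z = (y - x) - (z - x) := by abel
    rw [e1, e2]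
    generalize z - x = u
    generalize y - x = v
    rw [norm_add_sq_real, norm_sub_sq_real, norm_smul, norm_smul, inner_smul_left,
      inner_smul_right, mul_pow, mul_pow, Real.norm_eq_abs, Real.norm_eq_abs, sq_abs, sq_abs,
      real_inner_comm u v]
    simp only [conj_trivial, smul_eq_mul] at h1 ⊢
    obtain rfl : a = 1 - b := by linarith
    linarith
  refine { hs with μ_pos := hμ, p_convex := ⟨h.convexOn_gR.1, ?_⟩, xs_mem := hmem, opt := ?_ }
  · intro z hz y hy a b ha hb hab
    have h1 := hsc z hz y hy a b ha hb hab
    have h2 : 0 ≤ a * b * (μ / 2 * ‖y - z‖ ^ 2) := by positivity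
    change P.gR _ + μ / 2 * _ ≤ a * (P.gR z + _) + b * (P.gR y + _)
    linarith
  · intro y hy
    set Q := P.composite μ r ℓ x with hQ
    change P.gR Q.xs + μ / 2 * ‖Q.xs - x‖ ^ 2 + μ / 2 * ‖y - Q.xs‖ ^ 2 ≤
      P.gR y + μ / 2 * ‖y - x‖ ^ 2 + ⟪Q.gbar Q.xs, y - Q.xs⟫_ℝ
    -- `xs` is compared with a point of the segment towards y. The smooth part enters through
    -- `fbar_upper`, whose error ℓs²/2 ‖y - xs‖² survives division by s only with a factor s; `a`
    -- and `b` are arranged so that this error fits the pattern a + (1 - s)b.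
    have key := le_of_forall_one_sub_mul
      (a := P.gR Q.xs + μ / 2 * ‖Q.xs - x‖ ^ 2 - ℓ / 2 * ‖y - Q.xs‖ ^ 2)
      (b := (μ / 2 + ℓ / 2) * ‖y - Q.xs‖ ^ 2)
      (c := P.gR y + μ / 2 * ‖y - x‖ ^ 2 + ⟪Q.gbar Q.xs, y - Q.xs⟫_ℝ) (by
        intro s hs0 hs1
        have hs1' : 0 ≤ 1 - s := by linarith
        have h1 := hsc Q.xs hmem y hy (1 - s) s hs1' hs0.le (by ring)
        have h2 := hgr _ (h.convexOn_gR.1 hmem hy hs1' hs0.le (by ring))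
        have h3 := hs.fbar_upper Q.xs ((1 - s) • Q.xs + s • y)
        have e : (1 - s) • Q.xs + s • y - Q.xs = s • (y - Q.xs) := by module
        rw [e] at h2 h3
        rw [inner_smul_right, norm_smul, mul_pow, Real.norm_eq_abs, sq_abs] at h3
        have h4 : 0 ≤ μ / 2 * ‖s • (y - Q.xs)‖ ^ 2 := by positivity
        change Q.fbar _ ≤ Q.fbar Q.xs + s * ⟪Q.gbar Q.xs, y - Q.xs⟫_ℝ
          + ℓ / 2 * (s ^ 2 * ‖y - Q.xs‖ ^ 2) at h3
        refine le_of_mul_le_mul_left ?_ hs0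
        linarith)
    linarith

/-- The prox of `p` is obtained from that of `g`. -/
theorem norm_sub_center_sq {η t : ℝ} (hη : 0 < η) (ht : 0 < t) (y v x : Vec d) :
    1 / (2 * (η * t / (η + t))) * ‖y - (η + t)⁻¹ • (t • v + η • x)‖ ^ 2 =
      1 / (2 * η) * ‖y - v‖ ^ 2 + 1 / (2 * t) * ‖y - x‖ ^ 2
        - 1 / (2 * (η + t)) * ‖v - x‖ ^ 2 := by
  have hηt : η + t ≠ 0 := by positivity
  have e1 : y - (η + t)⁻¹ • (t • v + η • x) = (η + t)⁻¹ • (t • (y - v) + η • (y - x)) := by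
    have : y = (η + t)⁻¹ • ((η + t) • y) := by
      rw [smul_smul, inv_mul_cancel₀ hηt, one_smul]
    nth_rw 1 [this]
    rw [← smul_sub]
    congr 1
    module
  have e2 : v - x = (y - x) - (y - v) := by abel
  rw [e1, e2]
  generalize y - v = a
  generalize y - x = b
  rw [norm_smul, mul_pow, norm_add_sq_real, norm_sub_sq_real, norm_smul, norm_smul,
    inner_smul_left, inner_smul_right, mul_pow, mul_pow, Real.norm_eq_abs, Real.norm_eq_abs,
    Real.norm_eq_abs, sq_abs, sq_abs, sq_abs, real_inner_comm a b]
  simp only [conj_trivial]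
  field_simp
  ring

/-- After completing squares, the terms free of the test point cancel, and the curvature (η +
t)/(2ηt) splits as 1/(2η) + 1/(2t), the second part being the strong convexity of p. -/
theorem Assumptions.isProxStep (h : P.Assumptions L β B) {r ℓ η t : ℝ} (hη : 0 < η)
    (ht : 0 < t) (x x' v : Vec d) :
    (P.composite (1 / t) r ℓ x).IsProxStep η x' v
      (P.proxG (η * t / (η + t)) ((η + t)⁻¹ • (t • (x' - η • v) + η • x))) := by
  obtain ⟨h1, h2⟩ := h.proxG_spec (t := η * t / (η + t)) (by positivity)
    ((η + t)⁻¹ • (t • (x' - η • v) + η • x))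
  refine ⟨h1, fun y hy => ?_⟩
  have h3 := h2 y hy
  rw [norm_sub_center_sq hη ht, norm_sub_center_sq hη ht] at h3
  set u := P.proxG (η * t / (η + t)) ((η + t)⁻¹ • (t • (x' - η • v) + η • x))
  have e : ∀ w : Vec d, 1 / (2 * η) * ‖w - (x' - η • v)‖ ^ 2 =
      1 / (2 * η) * ‖w - x'‖ ^ 2 + ⟪v, w - x'⟫_ℝ + η / 2 * ‖v‖ ^ 2 := by
    intro w
    rw [show w - (x' - η • v) = (w - x') + η • v by abel, norm_add_sq_real, norm_smul,
      inner_smul_right, mul_pow, Real.norm_eq_abs, sq_abs, real_inner_comm v (w - x')]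
    field_simp
  rw [e, e] at h3
  have e2 : 1 / (2 * (η * t / (η + t))) = 1 / (2 * η) + 1 / t / 2 := by field_simp; ring
  have e3 : 1 / (2 * t) = 1 / t / 2 := by field_simp
  rw [e2, e3] at h3
  change P.gR u + 1 / t / 2 * ‖u - x‖ ^ 2 + ⟪v, u - x'⟫_ℝ + 1 / (2 * η) * ‖u - x'‖ ^ 2
      + (1 / (2 * η) + 1 / t / 2) * ‖y - u‖ ^ 2 ≤
    P.gR y + 1 / t / 2 * ‖y - x‖ ^ 2 + ⟪v, y - x'⟫_ℝ + 1 / (2 * η) * ‖y - x'‖ ^ 2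
  linarith

end Problem

namespace Problem

variable {d m : ℕ} (P : Problem d m)

/-! ### One outer step -/

/-- The subproblem that is solved in the outer step at `x`. -/
def subproblem (L β ε : ℝ) (x : Vec d) : Subproblem d m where
  ν := smoothing m L β ε
  t := 1 / (L * β)
  x := x
  cval i := P.c i x
  cgrad i := ∇ (P.c i) x
  ℓ := max (m / smoothing m L β ε * ⨆ i, ⟪∇ (P.c i) x, ∇ (P.c i) x⟫_ℝ) (L * β)

/-- The composite problem that is solved in the outer step at `x`. -/
def outerComposite (L β ε : ℝ) (x : Vec d) : Composite d m :=
  P.composite (L * β) (smoothing m L β ε / m) (P.subproblem L β ε x).ℓ x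

variable {P} {L β B ε : ℝ}

theorem always_collect_evalC (x : Vec d) :
    Always P (fun r => r = fun i => P.c i x) (collect fun i : Fin m => evalC i x pure) :=
  always_collect fun _ => rfl

theorem always_collect_evalGrad (x : Vec d) :
    Always P (fun r => r = fun i => ∇ (P.c i) x) (collect fun i : Fin m => evalGrad i x pure) :=
  always_collect fun _ => rfl

theorem always_collect_dot (x : Vec d) :
    Always P (fun r => r = fun i => ⟪∇ (P.c i) x, ∇ (P.c i) x⟫_ℝ)
      (collect fun i : Fin m => dot i x (∇ (P.c i) x) pure) :=
  always_collect fun _ => rfl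

theorem always_outerStep {R : Vec d → Prop} {x : Vec d}
    (h : Always P R ((P.subproblem L β ε x).solve x)) :
    Always P R (outerStep d m L β ε x) := by
  unfold outerStep
  refine (always_collect_evalC x).bind fun a ha => ?_
  refine (always_collect_evalGrad x).bind fun b hb => ?_
  subst ha hb
  refine (always_collect_dot x).bind
    fun s hs => ?_
  subst hs
  exact h

theorem expect_outerStep (hm : 0 < m) (f : Vec d → ℝ) (x : Vec d) :
    (outerStep d m L β ε x).expect P f = ((P.subproblem L β ε x).solve x).expect P f := by
  unfold outerStep
  simp only
  rw [expect_bind_of_always_eq hm (always_collect_evalC x),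
    expect_bind_of_always_eq hm (always_collect_evalGrad x),
    expect_bind_of_always_eq hm
      (always_collect_dot x)]
  rfl

/-- Reading values, gradients and squared gradient norms takes 3m operations; the initial
prox-gradient step takes 2m + 1. -/
theorem cost_outerStep_le (x : Vec d) :
    (outerStep d m L β ε x).cost P ≤ m * 5 + 1 + 4 * (P.subproblem L β ε x).work := by
  have h : (outerStep d m L β ε x).cost P ≤
      m * 1 + (m * 1 + (m * 1 + (m * 2 + 1 + 4 * (P.subproblem L β ε x).work))) := by
    unfold outerStep
    refine cost_bind_le (cost_collect_le fun i => le_rfl)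
      ((always_collect_evalC x).mono fun a ha => ?_)
    refine cost_bind_le (cost_collect_le fun i => le_rfl)
      ((always_collect_evalGrad x).mono fun b hb => ?_)
    subst ha hb
    refine cost_bind_le (cost_collect_le fun i => le_rfl)
      ((always_collect_dot x).mono
        fun s hs => ?_)
    subst hs
    exact Subproblem.cost_solve_le (S := P.subproblem L β ε x) x
  omega

theorem smoothing_pos (hm : 0 < m) (hL : 0 < L) (hβ : 0 < β) (hε : 0 < ε) :
    0 < smoothing m L β ε := by
  unfold smoothing; positivity

theorem smoothing_div (hm : 0 < m) (hL : 0 < L) (hβ : 0 < β) :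
    smoothing m L β ε / m = ε ^ 2 / (2 * L ^ 3 * β) := by
  have : (m : ℝ) ≠ 0 := by positivity
  unfold smoothing; field_simp

theorem norm_grad_sq_le (hm : 0 < m) (hL : 0 < L) (hβ : 0 < β) (hε : 0 < ε) (x : Vec d)
    (i : Fin m) :
    ‖∇ (P.c i) x‖ ^ 2 ≤ smoothing m L β ε / m * (P.subproblem L β ε x).ℓ := by
  have hν := smoothing_pos hm hL hβ hε
  have hm' : (0 : ℝ) < m := Nat.cast_pos.2 hm
  have h1 : ‖∇ (P.c i) x‖ ^ 2 ≤ ⨆ i, ⟪∇ (P.c i) x, ∇ (P.c i) x⟫_ℝ := by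
    rw [← real_inner_self_eq_norm_sq]
    exact le_ciSup (f := fun i => ⟪∇ (P.c i) x, ∇ (P.c i) x⟫_ℝ) (Set.finite_range _).bddAbove i
  calc ‖∇ (P.c i) x‖ ^ 2
      = smoothing m L β ε / m * (m / smoothing m L β ε * ‖∇ (P.c i) x‖ ^ 2) := by field_simp
    _ ≤ smoothing m L β ε / m * (P.subproblem L β ε x).ℓ := by
      gcongr
      refine le_trans ?_ (le_max_left _ _)
      gcongr

theorem Assumptions.represents (h : P.Assumptions L β B) (hm : 0 < m) (hL : 0 < L) (hβ : 0 < β)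
    (hε : 0 < ε) (x : Vec d) :
    (P.subproblem L β ε x).Represents P (P.outerComposite L β ε x) := by
  have hν := smoothing_pos hm hL hβ hε
  have hm' : (0 : ℝ) < m := Nat.cast_pos.2 hm
  have hμ : 0 < L * β := by positivity
  have hℓ : L * β ≤ (P.subproblem L β ε x).ℓ := le_max_right _ _
  refine ⟨?_, ?_, ?_, rfl, one_div_pos.2 hμ, (one_div_one_div _).symm, ?_⟩
  · exact h.valid_composite hm hμ (by positivity) (by linarith) (norm_grad_sq_le hm hL hβ hε x)
  · intro i z
    change (m / smoothing m L β ε * (P.lin i x z - P.proxH i (smoothing m L β ε / m)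
      (P.lin i x z))) • ∇ (P.c i) x = (1 / (smoothing m L β ε / m) * (P.lin i x z
      - P.proxH i (smoothing m L β ε / m) (P.lin i x z))) • ∇ (P.c i) x
    rw [one_div_div]
  · intro η hη x' v
    have := h.isProxStep (r := smoothing m L β ε / m) (ℓ := (P.subproblem L β ε x).ℓ) hη
      (one_div_pos.2 hμ) x x' v
    rwa [one_div_one_div] at this
  · change 1 ≤ (P.subproblem L β ε x).ℓ * (1 / (L * β))
    rw [mul_one_div, le_div_iff₀ hμ]
    linarith

/-- The factor m in ν cancels, so the conditioning does not depend on m. Membership in the domain is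
what makes B bound the gradients at x. -/
theorem Assumptions.κ_le (h : P.Assumptions L β B) (hm : 0 < m) (hL : 0 < L) (hβ : 0 < β)
    (hε : 0 < ε) (hB : 1 ≤ L * B / ε) {x : Vec d} (hx : x ∈ P.dom) :
    (P.subproblem L β ε x).κ ≤ 2 * (L * B / ε) ^ 2 := by
  have hμ : 0 < L * β := by positivity
  have hm' : (0 : ℝ) < m := Nat.cast_pos.2 hm
  have : Nonempty (Fin m) := ⟨⟨0, hm⟩⟩
  have h1 : ⨆ i, ⟪∇ (P.c i) x, ∇ (P.c i) x⟫_ℝ ≤ B ^ 2 := by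
    refine ciSup_le fun i => ?_
    rw [real_inner_self_eq_norm_sq]
    exact pow_le_pow_left₀ (norm_nonneg _) (h.grad_bound x hx i) 2
  have h2 : m / smoothing m L β ε = 2 * L ^ 3 * β / ε ^ 2 := by
    unfold smoothing; field_simp
  change max (m / smoothing m L β ε * ⨆ i, ⟪∇ (P.c i) x, ∇ (P.c i) x⟫_ℝ) (L * β)
    * (1 / (L * β)) ≤ _
  rw [mul_one_div, div_le_iff₀ hμ, h2]
  refine max_le ?_ ?_
  · calc _ ≤ 2 * L ^ 3 * β / ε ^ 2 * B ^ 2 := by gcongr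
      _ = _ := by field_simp
  · have : 1 ≤ 2 * (L * B / ε) ^ 2 := by nlinarith
    nlinarith

/-! ### Descent of the smoothed objective -/

/-- The real values of the objective on the domain of `g`. -/
def FR (P : Problem d m) (x : Vec d) : ℝ := avg (fun i => P.h i (P.c i x)) + P.gR x

/-- The smoothed objective. -/
def FS (P : Problem d m) (r : ℝ) (x : Vec d) : ℝ := avg (fun i => P.env i r (P.c i x)) + P.gR x

/-- The L-Lipschitz envelope turns the linearization error β/2 ‖z - x‖² into exactly the proximal
term of the model. -/
theorem Assumptions.FS_le_model (h : P.Assumptions L β B) (hm : 0 < m) (hL : 0 < L) {r ℓ : ℝ}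
    (hr : 0 < r) (x z : Vec d) :
    P.FS r z ≤ (P.composite (L * β) r ℓ x).fbar z + (P.composite (L * β) r ℓ x).p z := by
  have h1 : ∀ i, P.env i r (P.c i z) ≤ P.env i r (P.lin i x z) + L * β / 2 * ‖z - x‖ ^ 2 := by
    intro i
    have e1 := h.env_lip i hr (P.c i z) (P.lin i x z)
    have e2 := mul_le_mul_of_nonneg_left (h.abs_linearization_le i x z) hL.le
    rw [← lin] at e2
    linarith
  have h2 := avg_mono h1
  rw [avg_add, avg_const hm] at h2
  change avg _ + P.gR z ≤ avg (fun i => P.env i r (P.lin i x z))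
    + (P.gR z + L * β / 2 * ‖z - x‖ ^ 2)
  linarith

theorem FS_eq_model {μ r ℓ : ℝ} (x : Vec d) :
    (P.composite μ r ℓ x).fbar x + (P.composite μ r ℓ x).p x = P.FS r x := by
  change avg (fun i => P.env i r (P.lin i x x)) + (P.gR x + μ / 2 * ‖x - x‖ ^ 2) = _
  simp [FS, lin_self]

theorem Assumptions.always_outerStep_mem (h : P.Assumptions L β B) (hm : 0 < m) (hL : 0 < L)
    (hβ : 0 < β) (hε : 0 < ε) (x : Vec d) :
    Always P (fun u => u ∈ P.dom) (outerStep d m L β ε x) :=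
  always_outerStep ((h.represents hm hL hβ hε x).solve_spec x).1

/-- Strong convexity puts the model gap at x above μ/2 ‖x - z*‖², with μ = Lβ and z* the model's
minimizer; the solver leaves at most half of that in expectation. -/
theorem Assumptions.expect_outerStep_FS_le (h : P.Assumptions L β B) (hm : 0 < m) (hL : 0 < L)
    (hβ : 0 < β) (hε : 0 < ε) {x : Vec d} (hx : x ∈ P.dom) :
    (outerStep d m L β ε x).expect P (P.FS (smoothing m L β ε / m)) ≤
      P.FS (smoothing m L β ε / m) x
        - L * β / 4 * ‖x - (P.outerComposite L β ε x).xs‖ ^ 2 := by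
  have hν := smoothing_pos hm hL hβ hε
  have hm' : (0 : ℝ) < m := Nat.cast_pos.2 hm
  have R := h.represents hm hL hβ hε x
  have h1 := (R.solve_spec x).2
  have h2 := R.valid.growth hx
  rw [expect_outerStep hm]
  set Q := P.outerComposite L β ε x with hQ
  have h3 : ((P.subproblem L β ε x).solve x).expect P (P.FS (smoothing m L β ε / m)) ≤
      ((P.subproblem L β ε x).solve x).expect P (fun z => Q.gap z + (Q.fbar Q.xs + Q.p Q.xs)) := by
    refine expect_mono (always_of_forall (fun z => ?_) _)
    rw [Composite.gap, sub_add_cancel]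
    exact h.FS_le_model hm hL (by positivity) x z
  rw [expect_add, expect_const hm] at h3
  have h4 : Q.gap x = P.FS (smoothing m L β ε / m) x - (Q.fbar Q.xs + Q.p Q.xs) := by
    rw [Composite.gap, hQ, outerComposite, FS_eq_model]
  have h5 : 1 / (4 * (P.subproblem L β ε x).t) = L * β / 4 := by
    change 1 / (4 * (1 / (L * β))) = _
    field_simp
  have h6 : Q.μ = L * β := rfl
  rw [h5] at h1
  rw [h4, h6] at h2
  linarith

/-! ### The prox-gradient -/

theorem Assumptions.convexOn_linearized (h : P.Assumptions L β B) (x : Vec d) :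
    ConvexOn ℝ Set.univ fun z => avg fun i => P.h i (P.lin i x z) := by
  refine ⟨convex_univ, fun z _ w _ a b ha hb hab => ?_⟩
  have h1 : ∀ i, P.h i (P.lin i x (a • z + b • w)) ≤
      a * P.h i (P.lin i x z) + b * P.h i (P.lin i x w) := by
    intro i
    rw [lin_combo i x hab]
    exact (h.h_convex i).2 trivial trivial ha hb hab
  have h2 := avg_mono h1
  rwa [avg_add, avg_const_mul, avg_const_mul] at h2

/-- The two models differ by at most ε²/(4Lβ) everywhere. Adding quadratic growth of each at the
other's minimizer bounds the squared distance of the minimizers by ε²/(4(Lβ)²). -/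
theorem Assumptions.norm_proxGrad_sq_le (h : P.Assumptions L β B) (hm : 0 < m) (hL : 0 < L)
    (hβ : 0 < β) (hε : 0 < ε) (x : Vec d) :
    ‖P.proxGrad (1 / (L * β)) x‖ ^ 2 ≤
      2 * (L * β) ^ 2 * ‖x - (P.outerComposite L β ε x).xs‖ ^ 2 + ε ^ 2 / 2 := by
  have hν := smoothing_pos hm hL hβ hε
  have hm' : (0 : ℝ) < m := Nat.cast_pos.2 hm
  have hμ : 0 < L * β := by positivity
  have hr : 0 < smoothing m L β ε / m := by positivity
  have hδ : smoothing m L β ε / m * L ^ 2 / 2 = ε ^ 2 / (4 * (L * β)) := by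
    rw [smoothing_div hm hL hβ]; field_simp; ring
  have R := h.represents hm hL hβ hε x
  obtain ⟨hz, hzg⟩ := h.argmin_growth (q := fun z => avg fun i => P.h i (P.lin i x z)) (by
      unfold avg
      have h1 := fun i => h.continuous_h i
      have h2 := fun i => P.continuous_lin i x
      fun_prop) (h.convexOn_linearized x) (c := L * β / 2) (by positivity) x
    (f := P.model (1 / (L * β)) x) (fun z => by
      rw [model, add_comm, show 1 / (2 * (1 / (L * β))) = L * β / 2 by field_simp]
      rfl)
  rw [proxGrad]
  set Q := P.outerComposite L β ε x with hQ
  set zs := argmin (P.model (1 / (L * β)) x)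
  have hup := hzg Q.xs R.valid.xs_mem
  have hlo := R.valid.growth (y := zs) hz
  have e1 : Q.gap zs = avg (fun i => P.env i (smoothing m L β ε / m) (P.lin i x zs))
      + (P.gR zs + L * β / 2 * ‖zs - x‖ ^ 2)
      - (avg (fun i => P.env i (smoothing m L β ε / m) (P.lin i x Q.xs))
        + (P.gR Q.xs + L * β / 2 * ‖Q.xs - x‖ ^ 2)) := rfl
  have e2 : Q.μ = L * β := rfl
  rw [e1, e2] at hlo
  have b1 := avg_mono fun i => h.env_le i hr (P.lin i x zs)
  have b2 := avg_mono fun i => h.le_env_add i hr (P.lin i x Q.xs)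
  rw [avg_add, avg_const hm, hδ] at b2
  have h1 : (L * β) * ‖zs - Q.xs‖ ^ 2 ≤ ε ^ 2 / (4 * (L * β)) := by
    rw [norm_sub_rev Q.xs zs] at hup
    linarith
  have h2 : (L * β) ^ 2 * ‖zs - Q.xs‖ ^ 2 ≤ ε ^ 2 / 4 := by
    have := mul_le_mul_of_nonneg_left h1 hμ.le
    rw [show L * β * (ε ^ 2 / (4 * (L * β))) = ε ^ 2 / 4 by field_simp] at this
    linarith
  have h3 : ‖x - zs‖ ^ 2 ≤ 2 * ‖x - Q.xs‖ ^ 2 + 2 * ‖zs - Q.xs‖ ^ 2 := by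
    rw [show x - zs = (x - Q.xs) - (zs - Q.xs) by abel]
    have := parallelogram_law_with_norm ℝ (x - Q.xs) (zs - Q.xs)
    nlinarith [sq_nonneg ‖(x - Q.xs) + (zs - Q.xs)‖]
  rw [one_div, inv_inv, norm_smul, mul_pow, Real.norm_eq_abs, sq_abs]
  have h4 := mul_le_mul_of_nonneg_left h3 (sq_nonneg (L * β))
  linarith

/-! ### Convergence of the outer loop -/

theorem Assumptions.always_proxLinear (h : P.Assumptions L β B) (hm : 0 < m) (hL : 0 < L)
    (hβ : 0 < β) (hε : 0 < ε) {x₀ : Vec d} (hx₀ : x₀ ∈ P.dom) (N : ℕ) :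
    Always P (fun u => u ∈ P.dom) (proxLinear d m L β ε x₀ N) :=
  always_loop (fun _ u => u ∈ P.dom) hx₀ (fun _ b _ => h.always_outerStep_mem hm hL hβ hε b) N

theorem Assumptions.sum_expect_le (h : P.Assumptions L β B) (hm : 0 < m) (hL : 0 < L)
    (hβ : 0 < β) (hε : 0 < ε) {x₀ : Vec d} (hx₀ : x₀ ∈ P.dom) (N : ℕ) :
    (proxLinear d m L β ε x₀ N).expect P (P.FS (smoothing m L β ε / m))
      + L * β / 4 * ∑ j ∈ Finset.range N, (proxLinear d m L β ε x₀ j).expect P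
        (fun x => ‖x - (P.outerComposite L β ε x).xs‖ ^ 2)
      ≤ P.FS (smoothing m L β ε / m) x₀ := by
  induction N with
  | zero => simp [proxLinear, loop, pure, expect]
  | succ n ih =>
    have h1 : (proxLinear d m L β ε x₀ (n + 1)).expect P (P.FS (smoothing m L β ε / m)) ≤
        (proxLinear d m L β ε x₀ n).expect P (fun x => P.FS (smoothing m L β ε / m) x
          + -(L * β / 4) * ‖x - (P.outerComposite L β ε x).xs‖ ^ 2) := by
      rw [proxLinear, loop, expect_bind]
      refine expect_mono ((h.always_proxLinear hm hL hβ hε hx₀ n).mono fun x hx => ?_)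
      have := h.expect_outerStep_FS_le hm hL hβ hε hx
      linarith
    rw [expect_add, expect_const_mul] at h1
    rw [Finset.sum_range_succ, mul_add]
    linarith

/-- If all N iterates failed, each would have expected squared distance above ε²/(4μ²), where μ =
Lβ, for a total decrease above Nε²/(16μ). The smoothed objective can decrease only by F(x₀) - I +
ε²/(4μ), whence the 16 and the 4. -/
theorem Assumptions.exists_expect_le (h : P.Assumptions L β B) (hm : 0 < m) (hL : 0 < L)
    (hβ : 0 < β) (hε : 0 < ε) {x₀ : Vec d} (hx₀ : x₀ ∈ P.dom) {I : ℝ}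
    (hI : ∀ x ∈ P.dom, I ≤ P.FR x) {N : ℕ} (hN : 0 < N)
    (hNI : 16 * (L * β) * (P.FR x₀ - I) / ε ^ 2 + 4 ≤ N) :
    ∃ j < N, (proxLinear d m L β ε x₀ j).expect P
      (fun x => ‖P.proxGrad (1 / (L * β)) x‖ ^ 2) ≤ ε ^ 2 := by
  by_contra! hcon
  have hν := smoothing_pos hm hL hβ hε
  have hm' : (0 : ℝ) < m := Nat.cast_pos.2 hm
  have hμ : 0 < L * β := by positivity
  have hr : 0 < smoothing m L β ε / m := by positivity
  have hδ : smoothing m L β ε / m * L ^ 2 / 2 = ε ^ 2 / (4 * (L * β)) := by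
    rw [smoothing_div hm hL hβ]; field_simp; ring
  have h1 := h.sum_expect_le hm hL hβ hε hx₀ N
  have h2 : P.FS (smoothing m L β ε / m) x₀ ≤ P.FR x₀ := by
    have := avg_mono fun i => h.env_le i hr (P.c i x₀)
    simp only [FS, FR]
    linarith
  have h3 : I - ε ^ 2 / (4 * (L * β)) ≤
      (proxLinear d m L β ε x₀ N).expect P (P.FS (smoothing m L β ε / m)) := by
    rw [← expect_const (P := P) hm (I - ε ^ 2 / (4 * (L * β))) (proxLinear d m L β ε x₀ N)]
    refine expect_mono ((h.always_proxLinear hm hL hβ hε hx₀ N).mono fun x hx => ?_)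
    have e1 := hI x hx
    have e2 := avg_mono fun i => h.le_env_add i hr (P.c i x)
    rw [avg_add, avg_const hm, hδ] at e2
    simp only [FS, FR] at *
    linarith
  have h4 : ∀ j ∈ Finset.range N, ε ^ 2 / (4 * (L * β) ^ 2) <
      (proxLinear d m L β ε x₀ j).expect P
        (fun x => ‖x - (P.outerComposite L β ε x).xs‖ ^ 2) := by
    intro j hj
    have e1 := hcon j (Finset.mem_range.1 hj)
    have e2 : (proxLinear d m L β ε x₀ j).expect P
        (fun x => ‖P.proxGrad (1 / (L * β)) x‖ ^ 2) ≤ (proxLinear d m L β ε x₀ j).expect P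
        (fun x => 2 * (L * β) ^ 2 * ‖x - (P.outerComposite L β ε x).xs‖ ^ 2 + ε ^ 2 / 2) :=
      expect_mono (always_of_forall (fun x => h.norm_proxGrad_sq_le hm hL hβ hε x) _)
    rw [expect_add, expect_const hm, expect_const_mul] at e2
    rw [div_lt_iff₀ (by positivity)]
    linarith
  have h5 := Finset.sum_lt_sum_of_nonempty (Finset.nonempty_range_iff.2 hN.ne') h4
  rw [Finset.sum_const, Finset.card_range, nsmul_eq_mul] at h5
  have h6 := mul_lt_mul_of_pos_left h5 (show 0 < L * β / 4 by positivity)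
  have h7 : L * β / 4 * (N * (ε ^ 2 / (4 * (L * β) ^ 2))) = N * (ε ^ 2 / (16 * (L * β))) := by
    field_simp; ring
  have h8 : (16 * (L * β) * (P.FR x₀ - I) / ε ^ 2 + 4) * (ε ^ 2 / (16 * (L * β))) =
      P.FR x₀ - I + ε ^ 2 / (4 * (L * β)) := by field_simp; ring
  have h9 : (16 * (L * β) * (P.FR x₀ - I) / ε ^ 2 + 4) * (ε ^ 2 / (16 * (L * β))) ≤
      N * (ε ^ 2 / (16 * (L * β))) := by gcongr
  linarith

theorem Assumptions.cost_proxLinear_le (h : P.Assumptions L β B) (hm : 0 < m) (hL : 0 < L)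
    (hβ : 0 < β) (hε : 0 < ε) {x₀ : Vec d} (hx₀ : x₀ ∈ P.dom) {c : ℕ}
    (hc : ∀ x ∈ P.dom, (P.subproblem L β ε x).work ≤ c) (N : ℕ) :
    (proxLinear d m L β ε x₀ N).cost P ≤ N * (m * 5 + 1 + 4 * c) :=
  cost_loop_le (fun _ u => u ∈ P.dom) hx₀ (fun _ b _ => h.always_outerStep_mem hm hL hβ hε b)
    (fun _ b hb => (cost_outerStep_le b).trans (by have := hc b hb; omega)) N

/-! ### Values of the objective -/

theorem Assumptions.F_eq (h : P.Assumptions L β B) {x : Vec d} (hx : x ∈ P.dom) :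
    P.F x = (P.FR x : EReal) := by
  rw [F, h.coe_gR hx, ← EReal.coe_add]
  rfl

theorem Assumptions.toReal_iInf_le (h : P.Assumptions L β B) (hF : (⨅ x, P.F x) ≠ ⊥) {x : Vec d}
    (hx : x ∈ P.dom) : (⨅ x, P.F x).toReal ≤ P.FR x := by
  have := EReal.toReal_le_toReal (iInf_le P.F x) hF (by rw [h.F_eq hx]; exact EReal.coe_ne_top _)
  rwa [h.F_eq hx, EReal.toReal_coe] at this

end Problem

/-! ### Bounds on the number of operations -/

namespace Subproblem

variable {d m : ℕ} {S : Subproblem d m}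

/-- 41 = 10 · 4 + 1: the argument of the logarithm is at most ρ⁴, and log ρ ≥ 1 absorbs the
rounding. -/
theorem svrgT_le (hκ : 1 ≤ S.κ) {ρ : ℝ} (hρ : 4 ≤ ρ) (hκρ : S.κ ≤ 2 * ρ ^ 2) :
    (S.svrgT : ℝ) ≤ 41 * Real.log ρ := by
  have h1 : 1 / (1 / 10 : ℝ) * Real.log (4 * S.t * (S.ℓ / 2)) = 10 * Real.log (2 * S.κ) := by
    rw [κ]; norm_num; ring_nf
  have h0 : 0 ≤ Real.log (2 * S.κ) := Real.log_nonneg (by linarith)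
  have h2 : (S.svrgT : ℝ) ≤ 10 * Real.log (2 * S.κ) + 1 := by
    rw [svrgT, innerIter, h1]
    exact (Nat.ceil_lt_add_one (by positivity)).le
  have h3 : Real.log (2 * S.κ) ≤ 4 * Real.log ρ := by
    rw [show (4 : ℝ) * Real.log ρ = Real.log (ρ ^ 4) by rw [Real.log_pow]; norm_num]
    refine Real.log_le_log (by linarith) ?_
    have : 16 * ρ ^ 2 ≤ ρ ^ 2 * ρ ^ 2 := by gcongr; nlinarith
    linarith
  have h4 : 1 ≤ Real.log ρ := by
    rw [Real.le_log_iff_exp_le (by linarith)]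
    linarith [Real.exp_one_lt_d9]
  linarith

theorem svrgJ_le (hκ : 1 ≤ S.κ) : (S.svrgJ : ℝ) ≤ 101 * S.κ := by
  have := (Nat.ceil_lt_add_one (show 0 ≤ 100 * S.κ by linarith)).le
  rw [svrgJ]
  linarith

theorem katT_le (hm : 0 < m) (hκ : 1 ≤ S.κ) {ρ : ℝ} (hρ : 4 ≤ ρ) (hκρ : S.κ ≤ 2 * ρ ^ 2) :
    (S.katT : ℝ) ≤ (13 + 8 * (ρ / √m)) * Real.log ρ := by
  have hm' : (0 : ℝ) < m := Nat.cast_pos.2 hm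
  set s := √(2 * m / (3 * S.κ)) with hs
  have hs0 : 0 < s := Real.sqrt_pos.2 (by positivity)
  have h1 : 1 / (1 - max (1 + s)⁻¹ (3 / 2 : ℝ)⁻¹) ≤ 3 + 1 / s := by
    rcases le_total (1 + s)⁻¹ (3 / 2 : ℝ)⁻¹ with h | h
    · rw [max_eq_right h]
      norm_num
      positivity
    · rw [max_eq_left h]
      have : 1 - (1 + s)⁻¹ = s / (1 + s) := by field_simp; ring
      rw [this, one_div_div, add_div, div_self hs0.ne']
      linarith
  -- κ ≤ 2ρ² gives s² ≥ m/(3ρ²) ≥ m/(4ρ²).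
  have h2 : 1 / s ≤ 2 * (ρ / √m) := by
    have hsm : 0 < √(m : ℝ) := Real.sqrt_pos.2 hm'
    rw [div_le_iff₀ hs0]
    have e1 : √(m : ℝ) / (2 * ρ) ≤ s := by
      rw [hs]
      refine Real.le_sqrt_of_sq_le ?_
      rw [div_pow, Real.sq_sqrt hm'.le, div_le_div_iff₀ (by positivity) (by positivity)]
      nlinarith
    calc (1 : ℝ) = 2 * (ρ / √m) * (√(m : ℝ) / (2 * ρ)) := by field_simp
      _ ≤ _ := by gcongr
  have h3 : 4 * S.t * (4 * S.ℓ / 2) = 8 * S.κ := by rw [κ]; ring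
  have h0 : 0 ≤ Real.log (8 * S.κ) := Real.log_nonneg (by linarith)
  have h4 : Real.log (8 * S.κ) ≤ 4 * Real.log ρ := by
    rw [show (4 : ℝ) * Real.log ρ = Real.log (ρ ^ 4) by rw [Real.log_pow]; norm_num]
    refine Real.log_le_log (by linarith) ?_
    have : 16 * ρ ^ 2 ≤ ρ ^ 2 * ρ ^ 2 := by gcongr; nlinarith
    linarith
  have h5 : 1 ≤ Real.log ρ := by
    rw [Real.le_log_iff_exp_le (by linarith)]
    linarith [Real.exp_one_lt_d9]
  have h6 : 0 ≤ 1 / (1 - max (1 + s)⁻¹ (3 / 2 : ℝ)⁻¹) := by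
    have : (1 + s)⁻¹ < 1 := inv_lt_one_of_one_lt₀ (by linarith)
    have : max (1 + s)⁻¹ (3 / 2 : ℝ)⁻¹ < 1 := max_lt this (by norm_num)
    exact one_div_nonneg.2 (by linarith)
  have h7 : (S.katT : ℝ) ≤
      1 / (1 - max (1 + s)⁻¹ (3 / 2 : ℝ)⁻¹) * Real.log (8 * S.κ) + 1 := by
    rw [katT, innerIter, h3]
    exact (Nat.ceil_lt_add_one (mul_nonneg h6 h0)).le
  have h8 : 1 / (1 - max (1 + s)⁻¹ (3 / 2 : ℝ)⁻¹) * Real.log (8 * S.κ) ≤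
      (3 + 2 * (ρ / √m)) * (4 * Real.log ρ) := by
    apply mul_le_mul (by linarith) h4 h0 (by positivity)
  linarith

/-- As `work` is a minimum, either method may be used for the bound: Katyusha when √m ≤ ρ, Prox-SVRG
otherwise. The constant is 41 · 2 · 101 · 2, from the latter. -/
theorem work_le (hm : 0 < m) (hκ : 1 ≤ S.κ) {ρ : ℝ} (hρ : 4 ≤ ρ) (hκρ : S.κ ≤ 2 * ρ ^ 2) :
    (S.work : ℝ) ≤ 16564 * (Real.log ρ * (m + ρ * min (√m) ρ)) := by
  have hm' : (0 : ℝ) < m := Nat.cast_pos.2 hm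
  have hlog : 0 < Real.log ρ := Real.log_pos (by linarith)
  rcases le_total (√(m : ℝ)) ρ with h | h
  · rw [min_eq_left h]
    have h1 : (S.work : ℝ) ≤ S.katT * (3 * m) := by
      exact_mod_cast min_le_right _ _
    have h2 := katT_le hm hκ hρ hκρ
    have hsm : 0 < √(m : ℝ) := Real.sqrt_pos.2 hm'
    have hsq : √(m : ℝ) * √(m : ℝ) = m := Real.mul_self_sqrt hm'.le
    calc (S.work : ℝ) ≤ S.katT * (3 * m) := h1
      _ ≤ (13 + 8 * (ρ / √m)) * Real.log ρ * (3 * m) := by gcongr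
      _ = Real.log ρ * (39 * m + 24 * (ρ * (m / √m))) := by ring
      _ = Real.log ρ * (39 * m + 24 * (ρ * √m)) := by rw [Real.div_sqrt]
      _ ≤ Real.log ρ * (16564 * m + 16564 * (ρ * √m)) := by gcongr <;> norm_num
      _ = _ := by ring
  · rw [min_eq_right h]
    have h1 : (S.work : ℝ) ≤ S.svrgT * (m + 2 * S.svrgJ) := by
      exact_mod_cast min_le_left _ _
    have h2 := svrgT_le hκ hρ hκρ
    have h3 := svrgJ_le hκ
    calc (S.work : ℝ) ≤ S.svrgT * (m + 2 * S.svrgJ) := h1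
      _ ≤ 41 * Real.log ρ * (m + 2 * (101 * (2 * ρ ^ 2))) := by
        gcongr
        linarith
      _ = Real.log ρ * (41 * m + 16564 * (ρ * ρ)) := by ring
      _ ≤ Real.log ρ * (16564 * m + 16564 * (ρ * ρ)) := by gcongr; norm_num
      _ = _ := by ring

end Subproblem

end FiniteSum

end

/-! ### Choice of constants and assembly. -/

theorem mainTheorem3 :
    ∃ K : ℝ, 0 < K ∧ ∃ C : ℝ, 0 < C ∧
      ∀ (d m : ℕ) (_hm : 0 < m) (P : FiniteSum.Problem d m) (L β B ε : ℝ)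
        (x₀ : FiniteSum.Vec d),
        P.Assumptions L β B → 0 < ε → P.g x₀ ≠ ⊤ → (⨅ x, P.F x) ≠ ⊥ →
        K ≤ B → K ≤ L → K ≤ β → K ≤ (P.F x₀).toReal - (⨅ x, P.F x).toReal → K ≤ 1 / ε →
        ∃ N : ℕ,
          ((FiniteSum.proxLinear d m L β ε x₀ N).cost P : ℝ) ≤
            C * ((L * β * m / ε ^ 2
                  + L ^ 2 * β * B / ε ^ 3 * min (√(m : ℝ)) (L * B / ε))
                * ((P.F x₀).toReal - (⨅ x, P.F x).toReal)
                * Real.log (L * B / ε)) ∧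
          ∃ j < N,
            (FiniteSum.proxLinear d m L β ε x₀ j).expect P
              (fun x => ‖P.proxGrad (1 / (L * β)) x‖ ^ 2) ≤ ε ^ 2 := by
  -- K = 2 ensures ρ ≥ 8 and A ≥ 1, so that rounding and additive constants are absorbed. C only has
  -- to exceed 21 · 66262.
  refine ⟨2, by norm_num, 2000000, by norm_num, ?_⟩
  intro d m hm P L β B ε x₀ h hε hx₀ hF hB hL hβ hΔ hε1
  have hm' : (1 : ℝ) ≤ m := by exact_mod_cast hm
  have hx₀' : x₀ ∈ P.dom := hx₀
  have hL0 : 0 < L := by linarith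
  have hβ0 : 0 < β := by linarith
  have hI : ∀ x ∈ P.dom, (⨅ x, P.F x).toReal ≤ P.FR x := fun x hx => h.toReal_iInf_le hF hx
  rw [h.F_eq hx₀', EReal.toReal_coe] at hΔ ⊢
  set Δ := P.FR x₀ - (⨅ x, P.F x).toReal with hΔdef
  set ρ := L * B / ε with hρdef
  have hρ : 8 ≤ ρ := by
    have h1 : 2 * 2 ≤ L * B := by gcongr
    have h2 : 4 * 2 ≤ L * B * (1 / ε) := by
      apply mul_le_mul <;> linarith
    rw [hρdef, div_eq_mul_one_div]
    linarith
  have hlog : 1 ≤ Real.log ρ := by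
    rw [Real.le_log_iff_exp_le (by linarith)]
    linarith [Real.exp_one_lt_d9]
  set A := L * β * Δ / ε ^ 2 with hA
  have hA1 : 1 ≤ A := by
    have h1 : 2 * 2 ≤ L * β := by gcongr
    have h2 : 4 * 2 ≤ L * β * Δ := by apply mul_le_mul <;> linarith
    have h3 : ε ≤ 1 / 2 := by
      rw [le_div_iff₀ hε] at hε1
      linarith
    rw [hA, le_div_iff₀ (by positivity)]
    nlinarith
  set N := ⌈16 * (L * β) * Δ / ε ^ 2 + 4⌉₊ with hN
  have hNe : 16 * (L * β) * Δ / ε ^ 2 + 4 = 16 * A + 4 := by rw [hA]; ring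
  have hNlow : 16 * (L * β) * Δ / ε ^ 2 + 4 ≤ N := Nat.le_ceil _
  -- The ceiling is at most 16A + 5, and A ≥ 1.
  have hNup : (N : ℝ) ≤ 21 * A := by
    have := (Nat.ceil_lt_add_one (show 0 ≤ 16 * (L * β) * Δ / ε ^ 2 + 4 by
      rw [hNe]; linarith)).le
    rw [← hN, hNe] at this
    linarith
  have hN0 : 0 < N := by
    have : (0 : ℝ) < N := by rw [hNe] at hNlow; linarith
    exact_mod_cast this
  refine ⟨N, ?_, h.exists_expect_le hm hL0 hβ0 hε hx₀' hI hN0 hNlow⟩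
  set W := Real.log ρ * (m + ρ * min (√(m : ℝ)) ρ) with hW
  have hmin : 0 ≤ min (√(m : ℝ)) ρ := le_min (Real.sqrt_nonneg _) (by linarith)
  have hWm : m ≤ W := by
    have : 1 * (m : ℝ) ≤ W := by
      rw [hW]
      apply mul_le_mul hlog _ (by linarith) (by linarith)
      have : 0 ≤ ρ * min (√(m : ℝ)) ρ := mul_nonneg (by linarith) hmin
      linarith
    linarith
  have hwork : ∀ x ∈ P.dom, (P.subproblem L β ε x).work ≤ ⌊16564 * W⌋₊ := by
    intro x hx
    refine Nat.le_floor ?_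
    exact FiniteSum.Subproblem.work_le hm (h.represents hm hL0 hβ0 hε x).one_le_κ (by linarith)
      (h.κ_le hm hL0 hβ0 hε (by linarith) hx)
  have hcost : ((FiniteSum.proxLinear d m L β ε x₀ N).cost P : ℝ) ≤
      N * (m * 5 + 1 + 4 * ⌊16564 * W⌋₊) := by
    exact_mod_cast h.cost_proxLinear_le hm hL0 hβ0 hε hx₀' hwork N
  have hfl : (⌊16564 * W⌋₊ : ℝ) ≤ 16564 * W := Nat.floor_le (by linarith)
  calc _ ≤ N * (m * 5 + 1 + 4 * (⌊16564 * W⌋₊ : ℝ)) := hcost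
    -- 66262 = 5 + 1 + 4 · 16564, using 1 ≤ m ≤ W.
    _ ≤ 21 * A * (66262 * W) := by
      apply mul_le_mul hNup (by linarith) (by positivity) (by linarith)
    _ ≤ 2000000 * (A * W) := by
      have : 0 ≤ A * W := mul_nonneg (by linarith) (by linarith)
      linarith
    _ = _ := by
      rw [hA, hW, hρdef]
      field_simp
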